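/- Let $\pi:Y\to X$ be a fibered manifold (a smooth surjective submersion) with $\dim X=2$, $\dim Y=2+m$, let $J^rY$ be its $r$-th jet prolongation, and for a fibered chart $(V,\psi)$, $\psi=(x^i,y^\sigma)$, $1\le i\le 2$, $1\le\sigma\le m$, on $Y$ let $(V^r,\psi^r)$, $\psi^r=(x^i,y^\sigma,y^\sigma_{j},\dots,y^\sigma_{j_1\dots j_r})$, be the associated chart on $J^rY$. Repeated indices are summed over all their values, and $\partial/\partial y^\sigma_{ij}$ is the symmetrized partial derivative, $\partial y^\nu_{pq}/\partial y^\sigma_{ij}=\frac12\delta^\nu_\sigma(\delta^i_p\delta^j_q+\delta^i_q\delta^j_p)$ (so $\partial/\partial y^\sigma_{12}$ is one half of the ordinary derivative in the coordinate $y^\sigma_{12}=y^\sigma_{21}$). For a function $f$ on $V^r$ put $$d_if=\frac{\partial f}{\partial x^i}+\sum_{|J|\le r}y^\sigma_{Ji}\,\partial_{y^\sigma_J}f\quad(\text{on }V^{r+1}),\qquad d_i'f=\frac{\partial f}{\partial x^i}+\sum_{|J|\le r-1}y^\sigma_{Ji}\,\partial_{y^\sigma_J}f\quad(\text{on }V^r),$$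 where $J$ runs over the unordered multi-indices and $\partial_{y^\sigma_J}$ is the ordinary partial derivative in the coordinate $y^\sigma_J$. Put $\omega_0=dx^1\wedge dx^2$, $\omega_1=dx^2$, $\omega_2=-dx^1$, $\omega^\sigma=dy^\sigma-y^\sigma_i\,dx^i$, $\omega^\sigma_j=dy^\sigma_j-y^\sigma_{ji}\,dx^i$. Let $\lambda$ be a second-order Lagrangian, that is, a smooth $\pi^2$-horizontal $2$-form on $J^2Y$ (where $\pi^2:J^2Y\to X$ is the projection), $\lambda=\mathscr L\,\omega_0$ on $V^2$ in each fibered chart, and assume that in every fibered chart, for all indices, $$\frac{\partial^2\mathscr L}{\partial y^\nu_{pq}\partial y^\sigma_{ij}}+\frac{\partial^2\mathscr L}{\partial y^\nu_{ip}\partial y^\sigma_{qj}}+\frac{\partial^2\mathscr L}{\partial y^\nu_{qi}\partial y^\sigma_{pj}}=0 .$$ Call $\lambda$ variationally trivial if in every fibered chart $$\frac{\partial\mathscr L}{\partial y^\sigma}-d_i\frac{\partial\mathscr L}{\partial y^\sigma_i}+d_id_j\frac{\partial\mathscr L}{\partial y^\sigma_{ij}}=0\quad\text{on }V^4\text{ for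 all }\sigma.$$ In a fibered chart $(V,\psi)$ let $$\Theta_\lambda=\mathscr L\omega_0+\Big(\frac{\partial\mathscr L}{\partial y^\sigma_j}-d_i\frac{\partial\mathscr L}{\partial y^\sigma_{ij}}\Big)\omega^\sigma\wedge\omega_j+\frac{\partial\mathscr L}{\partial y^\sigma_{ij}}\,\omega^\sigma_i\wedge\omega_j,$$ and, for smooth functions $P_{\sigma\nu},Q^j_{\sigma,\nu},R^{i,j}_{\sigma,\nu}$ on $V^3$ with $P_{\sigma\nu}=-P_{\nu\sigma}$ and $R^{i,j}_{\sigma,\nu}=-R^{j,i}_{\nu,\sigma}$, let $$Z_\lambda=\Theta_\lambda+\tfrac12P_{\sigma\nu}\,\omega^\sigma\wedge\omega^\nu+Q^j_{\sigma,\nu}\,\omega^\sigma\wedge\omega^\nu_j+\tfrac12R^{i,j}_{\sigma,\nu}\,\omega^\sigma_i\wedge\omega^\nu_j .$$ Consider the functions of second order \begin{align*} P_{\sigma\nu}&=\tfrac12\Big(\tfrac{\partial^2\mathscr L}{\partial y^\sigma_1\partial y^\nu_2}-\tfrac{\partial^2\mathscr L}{\partial y^\nu_1\partial y^\sigma_2}\Big)+d_1'\Big(\tfrac{\partial^2\mathscr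 L}{\partial y^\nu_1\partial y^\sigma_{12}}-\tfrac{\partial^2\mathscr L}{\partial y^\sigma_1\partial y^\nu_{12}}\Big)+d_2'\Big(\tfrac{\partial^2\mathscr L}{\partial y^\sigma_2\partial y^\nu_{12}}-\tfrac{\partial^2\mathscr L}{\partial y^\nu_2\partial y^\sigma_{12}}\Big),\\ Q^1_{\sigma,\nu}&=2\tfrac{\partial^2\mathscr L}{\partial y^\sigma_1\partial y^\nu_{12}}-\tfrac{\partial^2\mathscr L}{\partial y^\nu_1\partial y^\sigma_{12}}-\tfrac{\partial^2\mathscr L}{\partial y^\nu_2\partial y^\sigma_{11}}-2d_2'\tfrac{\partial^2\mathscr L}{\partial y^\sigma_{12}\partial y^\nu_{12}},\\ Q^2_{\sigma,\nu}&=-2\tfrac{\partial^2\mathscr L}{\partial y^\sigma_2\partial y^\nu_{12}}+\tfrac{\partial^2\mathscr L}{\partial y^\nu_1\partial y^\sigma_{22}}+\tfrac{\partial^2\mathscr L}{\partial y^\nu_2\partial y^\sigma_{12}}+2d_1'\tfrac{\partial^2\mathscr L}{\partial y^\sigma_{12}\partial y^\nu_{12}},\\ R^{1,2}_{\sigma,\nu}&=-2\tfrac{\partial^2\mathscr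 L}{\partial y^\sigma_{12}\partial y^\nu_{12}}=-R^{2,1}_{\sigma,\nu},\qquad R^{1,1}_{\sigma,\nu}=R^{2,2}_{\sigma,\nu}=0.\tag{$*$} \end{align*} Then in every fibered chart the functions $(*)$ are smooth and satisfy the skew-symmetry conditions above, and if $\lambda$ is variationally trivial, then $Z_\lambda$ is closed on $V^3$ if and only if its coefficients $P_{\sigma\nu},Q^j_{\sigma,\nu},R^{i,j}_{\sigma,\nu}$ are given by $(*)$ on $V^3$. (The form $Z_\lambda$ with coefficients $(*)$ is called the fundamental Lepage equivalent of $\lambda$.) -/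

import Mathlib

open scoped Manifold ContDiff

noncomputable section

namespace FundLepage

/-! ### Fibered manifolds over a two-dimensional base, fibered charts, jets of sections

Base indices `1, 2` are represented by `0, 1 : Fin 2`. -/

section Geometry

variable {m : ℕ} {X Y : Type*}
  [TopologicalSpace X] [ChartedSpace (EuclideanSpace ℝ (Fin 2)) X]
  [TopologicalSpace Y] [ChartedSpace (EuclideanSpace ℝ (Fin (2 + m))) Y]

/-- `π : Y → X` is a smooth surjective submersion. -/
structure IsFibered (π : Y → X) : Prop where
  smooth : ContMDiff (𝓡 (2 + m)) (𝓡 2) ∞ π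
  surjective : Function.Surjective π
  submersion : ∀ y, Function.Surjective (mfderiv (𝓡 (2 + m)) (𝓡 2) π y)

/-- A fibered chart `(V, ψ)`, `ψ = (xⁱ, y^σ)`, on `Y`, with its associated chart `(π(V), φ)`,
`φ = (xⁱ)`, on `X`. -/
structure FiberedChart (π : Y → X) where
  ψ : OpenPartialHomeomorph Y ((Fin 2 → ℝ) × (Fin m → ℝ))
  φ : OpenPartialHomeomorph X (Fin 2 → ℝ)
  smooth_ψ : ContMDiffOn (𝓡 (2 + m)) 𝓘(ℝ, (Fin 2 → ℝ) × (Fin m → ℝ)) ∞ ψ ψ.source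
  smooth_ψ_symm : ContMDiffOn 𝓘(ℝ, (Fin 2 → ℝ) × (Fin m → ℝ)) (𝓡 (2 + m)) ∞ ψ.symm ψ.target
  smooth_φ : ContMDiffOn (𝓡 2) 𝓘(ℝ, Fin 2 → ℝ) ∞ φ φ.source
  smooth_φ_symm : ContMDiffOn 𝓘(ℝ, Fin 2 → ℝ) (𝓡 2) ∞ φ.symm φ.target
  source_φ : φ.source = π '' ψ.source
  fst_ψ : ∀ y ∈ ψ.source, (ψ y).1 = φ (π y)

/-- A smooth section `γ` of `π` over an open set `dom`, together with a point `base ∈ dom`. -/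
structure PointedSection (π : Y → X) where
  base : X
  dom : Set X
  isOpen_dom : IsOpen dom
  base_mem : base ∈ dom
  γ : X → Y
  smooth : ContMDiffOn (𝓡 2) (𝓡 (2 + m)) ∞ γ dom
  isSection : ∀ x ∈ dom, π (γ x) = x

/-- The components `y^σ ∘ γ ∘ φ⁻¹` of a section in a fibered chart. -/
def FiberedChart.rep {π : Y → X} (c : FiberedChart (m := m) π)
    (s : PointedSection (m := m) π) : (Fin 2 → ℝ) → (Fin m → ℝ) :=
  fun u => (c.ψ (s.γ (c.φ.symm u))).2

/-- Two pointed sections have the same `r`-jet: same source, same target, and in every fibered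
chart around the target all partial derivatives of the components up to order `r` agree. -/
def jetSetoid (π : Y → X) (r : ℕ) : Setoid (PointedSection (m := m) π) where
  r s t := s.base = t.base ∧ s.γ s.base = t.γ t.base ∧
    ∀ c : FiberedChart (m := m) π, s.γ s.base ∈ c.ψ.source → ∀ k ≤ r,
      iteratedFDeriv ℝ k (c.rep s) (c.φ s.base) = iteratedFDeriv ℝ k (c.rep t) (c.φ t.base)
  iseqv :=
    { refl := fun _ => ⟨rfl, rfl, fun _ _ _ _ => rfl⟩
      symm := fun h => ⟨h.1.symm, h.2.1.symm,
        fun c hc k hk => (h.2.2 c (h.2.1 ▸ hc) k hk).symm⟩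
      trans := fun h h' => ⟨h.1.trans h'.1, h.2.1.trans h'.2.1,
        fun c hc k hk => (h.2.2 c hc k hk).trans (h'.2.2 c (h.2.1 ▸ hc) k hk)⟩ }

/-- The set of points of the jet prolongation `Jʳ Y`: `r`-jets of local sections. -/
def Jet (m : ℕ) {X Y : Type*}
    [TopologicalSpace X] [ChartedSpace (EuclideanSpace ℝ (Fin 2)) X]
    [TopologicalSpace Y] [ChartedSpace (EuclideanSpace ℝ (Fin (2 + m))) Y]
    (π : Y → X) (r : ℕ) : Type _ :=
  Quotient (jetSetoid (m := m) π r)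

/-- The `r`-jet of `γ` at its base point. -/
def PointedSection.jet {π : Y → X} (s : PointedSection (m := m) π) (r : ℕ) : Jet m π r :=
  Quotient.mk (jetSetoid (m := m) π r) s

/-- The projection `Jʳ Y → X`. -/
def Jet.base {π : Y → X} {r : ℕ} (j : Jet m π r) : X :=
  Quotient.lift (s := jetSetoid (m := m) π r) (fun s : PointedSection (m := m) π => s.base)
    (fun _ _ h => And.left h) j

end Geometry

/-! ### Coordinates on jet prolongations, formal derivatives -/

/-- The space of the jet coordinates `(xⁱ, y^σ_J)`, `|J| ≤ r`. A multi-index `J = (j₁ ≤ … ≤ j_k)`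
over `{1, 2}` is encoded by its length `k` and the number `l ≤ k` of its entries equal to `2`;
`p.1 i` is `xⁱ` and `p.2 k l σ` is `y^σ_J`. -/
abbrev JetCoords (m r : ℕ) : Type :=
  (Fin 2 → ℝ) × ((k : Fin (r + 1)) → Fin ((k : ℕ) + 1) → Fin m → ℝ)

section Coordinates

variable {m r : ℕ}

/-- The canonical projection `J^{r+1} Y → J^r Y` in coordinates. -/
def proj (p : JetCoords m (r + 1)) : JetCoords m r :=
  (p.1, fun k l σ => p.2 k.castSucc l σ)

/-- The coordinate vector `∂/∂y^σ_J`, `J` of length `k` with `l` entries `2`. -/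
def vecY (k l : ℕ) (hk : k < r + 1) (hl : l < k + 1) (σ : Fin m) : JetCoords m r :=
  (0, Pi.single ⟨k, hk⟩ (Pi.single ⟨l, hl⟩ (Pi.single σ 1)))

/-- The vector `∂/∂xⁱ + ∑_{|J| ≤ r} y^σ_{Ji} ∂/∂y^σ_J` along `J^{r+1} Y → J^r Y`. -/
def formalVec (i : Fin 2) (p : JetCoords m (r + 1)) : JetCoords m r :=
  (Pi.single i 1, fun k l σ =>
    p.2 k.succ ⟨(l : ℕ) + (i : ℕ), by
      have h := l.isLt; have h' := i.isLt; simp only [Fin.val_succ]; omega⟩ σ)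

/-- The vector `∂/∂xⁱ + ∑_{|J| ≤ r - 1} y^σ_{Ji} ∂/∂y^σ_J` on `J^r Y`. -/
def cutVec (i : Fin 2) (p : JetCoords m r) : JetCoords m r :=
  (Pi.single i 1, fun k l σ =>
    if h : (k : ℕ) < r then
      p.2 ⟨(k : ℕ) + 1, by omega⟩ ⟨(l : ℕ) + (i : ℕ), by
        have h := l.isLt; have h' := i.isLt; simp only; omega⟩ σ
    else 0)

/-- The formal derivative `d_i`. -/
def formalD (i : Fin 2) (f : JetCoords m r → ℝ) : JetCoords m (r + 1) → ℝ :=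
  fun p => fderiv ℝ f (proj p) (formalVec i p)

/-- The cut formal derivative `d'_i`. -/
def cutD (i : Fin 2) (f : JetCoords m r → ℝ) : JetCoords m r → ℝ :=
  fun p => fderiv ℝ f p (cutVec i p)

/-- `∂f/∂y^σ` for a function of second order. -/
def dY (σ : Fin m) (f : JetCoords m 2 → ℝ) : JetCoords m 2 → ℝ :=
  fun p => fderiv ℝ f p (vecY 0 0 (by omega) (by omega) σ)

/-- `∂f/∂y^σ_j` for a function of second order. -/
def dY1 (j : Fin 2) (σ : Fin m) (f : JetCoords m 2 → ℝ) : JetCoords m 2 → ℝ :=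
  fun p => fderiv ℝ f p (vecY 1 j (by omega) (by omega) σ)

/-- `∂f/∂y^σ_{ij}` for a function of second order, with the usual convention for sums over all
`i, j`: `∂y^σ_{pq}/∂y^σ_{ij}` is the symmetrized Kronecker symbol, so that for `i ≠ j` this is one
half of the derivative in the coordinate `y^σ_{12}`. -/
def dY2 (i j : Fin 2) (σ : Fin m) (f : JetCoords m 2 → ℝ) : JetCoords m 2 → ℝ :=
  fun p => (if i = j then 1 else 1 / 2) *
    fderiv ℝ f p (vecY 2 ((i : ℕ) + (j : ℕ)) (by omega) (by omega) σ)

/-! ### Differential forms in jet coordinates -/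

/-- The 1-form `dxⁱ`. -/
def dx (i : Fin 2) : JetCoords m r →L[ℝ] ℝ :=
  (ContinuousLinearMap.proj i).comp (ContinuousLinearMap.fst ℝ _ _)

/-- The 1-form `dy^σ_J`. -/
def dyForm (k l : ℕ) (hk : k < r + 1) (hl : l < k + 1) (σ : Fin m) : JetCoords m r →L[ℝ] ℝ :=
  (ContinuousLinearMap.proj σ).comp
    ((ContinuousLinearMap.proj (R := ℝ) (φ := fun _ : Fin (k + 1) => Fin m → ℝ) ⟨l, hl⟩).comp
      ((ContinuousLinearMap.proj (R := ℝ)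
        (φ := fun k : Fin (r + 1) => Fin ((k : ℕ) + 1) → Fin m → ℝ) ⟨k, hk⟩).comp
        (ContinuousLinearMap.snd ℝ _ _)))

/-- The contact 1-form `ω^σ_J = dy^σ_J - y^σ_{Ji} dxⁱ`, `|J| ≤ r - 1`. -/
def contact (k l : ℕ) (hk : k < r) (hl : l < k + 1) (σ : Fin m) (p : JetCoords m r) :
    JetCoords m r →L[ℝ] ℝ :=
  dyForm k l (by omega) hl σ -
    ∑ i : Fin 2, p.2 ⟨k + 1, by omega⟩ ⟨l + (i : ℕ), by simp only; omega⟩ σ • dx i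

/-- The wedge product of two linear forms. -/
def wedge {E : Type*} [NormedAddCommGroup E] [NormedSpace ℝ E] (α β : E →L[ℝ] ℝ) :
    E [⋀^Fin 2]→L[ℝ] ℝ :=
  ContinuousMultilinearMap.alternatization
    ((ContinuousMultilinearMap.mkPiAlgebra ℝ (Fin 2) ℝ).compContinuousLinearMap ![α, β])

theorem wedge_apply {E : Type*} [NormedAddCommGroup E] [NormedSpace ℝ E] (α β : E →L[ℝ] ℝ)
    (v : Fin 2 → E) : wedge α β v = α (v 0) * β (v 1) - α (v 1) * β (v 0) := by
  have hu : (Finset.univ : Finset (Equiv.Perm (Fin 2))) = {1, Equiv.swap 0 1} := by decide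
  have hne : (1 : Equiv.Perm (Fin 2)) ≠ Equiv.swap 0 1 := by decide
  rw [wedge, ContinuousMultilinearMap.alternatization_apply_apply, hu, Finset.sum_pair hne]
  simp [Fin.prod_univ_two, sub_eq_add_neg]

/-- `ω_j = i_{∂/∂x^j} (dx¹ ∧ dx²)`, that is `ω_1 = dx²` and `ω_2 = -dx¹`. -/
def omegaBase (j : Fin 2) : JetCoords m r →L[ℝ] ℝ :=
  if j = 0 then dx 1 else -dx 0

/-- The contact form `ω^σ` on the third jet prolongation. -/
def om (σ : Fin m) (p : JetCoords m 3) : JetCoords m 3 →L[ℝ] ℝ :=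
  contact 0 0 (by omega) (by omega) σ p

/-- The contact form `ω^σ_j` on the third jet prolongation. -/
def om1 (j : Fin 2) (σ : Fin m) (p : JetCoords m 3) : JetCoords m 3 →L[ℝ] ℝ :=
  contact 1 j (by omega) (by omega) σ p

/-! ### Chart expressions attached to a second-order Lagrange function -/

/-- The order-reducibility condition at a point. -/
def OrderConditionAt (L : JetCoords m 2 → ℝ) (z : JetCoords m 2) : Prop :=
  ∀ (p q i j : Fin 2) (σ ν : Fin m),
    dY2 p q ν (dY2 i j σ L) z + dY2 i p ν (dY2 q j σ L) z + dY2 q i ν (dY2 p j σ L) z = 0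

/-- The Euler–Lagrange expressions `∂L/∂y^σ - d_i ∂L/∂y^σ_i + d_i d_j ∂L/∂y^σ_{ij}`. -/
def eulerLagrange (L : JetCoords m 2 → ℝ) (σ : Fin m) (z : JetCoords m 4) : ℝ :=
  dY σ L (proj (proj z)) - ∑ i : Fin 2, formalD i (dY1 i σ L) (proj z)
    + ∑ i : Fin 2, ∑ j : Fin 2, formalD i (formalD j (dY2 i j σ L)) z

/-- The generalized Poincaré–Cartan form
`Θ = L ω_0 + (∂L/∂y^σ_j - d_i ∂L/∂y^σ_{ij}) ω^σ ∧ ω_j + ∂L/∂y^σ_{ij} ω^σ_i ∧ ω_j`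
on the third jet prolongation. -/
def poincareCartan (L : JetCoords m 2 → ℝ) (z : JetCoords m 3) :
    JetCoords m 3 [⋀^Fin 2]→L[ℝ] ℝ :=
  L (proj z) • wedge (dx 0) (dx 1)
    + ∑ σ : Fin m, ∑ j : Fin 2,
        (dY1 j σ L (proj z) - ∑ i : Fin 2, formalD i (dY2 i j σ L) z) •
          wedge (om σ z) (omegaBase j)
    + ∑ σ : Fin m, ∑ i : Fin 2, ∑ j : Fin 2,
        dY2 i j σ L (proj z) • wedge (om1 i σ z) (omegaBase j)

/-- Coefficients `P_{σν}`, `Q^j_{σ,ν}`, `R^{i,j}_{σ,ν}`: functions of third order. -/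
structure Coeffs (m : ℕ) where
  P : Fin m → Fin m → JetCoords m 3 → ℝ
  Q : Fin 2 → Fin m → Fin m → JetCoords m 3 → ℝ
  R : Fin 2 → Fin 2 → Fin m → Fin m → JetCoords m 3 → ℝ

/-- The coefficients are smooth on `D`, with `P` skew-symmetric in `σ, ν` and `R` skew-symmetric
in the pairs `(i, σ), (j, ν)`. -/
structure Coeffs.Admissible (K : Coeffs m) (D : Set (JetCoords m 3)) : Prop where
  smooth_P : ∀ σ ν, ContDiffOn ℝ ∞ (K.P σ ν) D
  smooth_Q : ∀ j σ ν, ContDiffOn ℝ ∞ (K.Q j σ ν) D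
  smooth_R : ∀ i j σ ν, ContDiffOn ℝ ∞ (K.R i j σ ν) D
  skew_P : ∀ σ ν, ∀ z ∈ D, K.P σ ν z = -K.P ν σ z
  skew_R : ∀ i j σ ν, ∀ z ∈ D, K.R i j σ ν z = -K.R j i ν σ z

/-- The coefficients agree on `D`. -/
def Coeffs.EqOn (K K' : Coeffs m) (D : Set (JetCoords m 3)) : Prop :=
  ∀ z ∈ D, (∀ σ ν, K.P σ ν z = K'.P σ ν z) ∧ (∀ j σ ν, K.Q j σ ν z = K'.Q j σ ν z) ∧
    (∀ i j σ ν, K.R i j σ ν z = K'.R i j σ ν z)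

/-- `Z = Θ + ½ P_{σν} ω^σ ∧ ω^ν + Q^j_{σ,ν} ω^σ ∧ ω^ν_j + ½ R^{i,j}_{σ,ν} ω^σ_i ∧ ω^ν_j`. -/
def ansatz (L : JetCoords m 2 → ℝ) (K : Coeffs m) (z : JetCoords m 3) :
    JetCoords m 3 [⋀^Fin 2]→L[ℝ] ℝ :=
  poincareCartan L z
    + ∑ σ : Fin m, ∑ ν : Fin m, ((1 / 2 : ℝ) * K.P σ ν z) • wedge (om σ z) (om ν z)
    + ∑ j : Fin 2, ∑ σ : Fin m, ∑ ν : Fin m, K.Q j σ ν z • wedge (om σ z) (om1 j ν z)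
    + ∑ i : Fin 2, ∑ j : Fin 2, ∑ σ : Fin m, ∑ ν : Fin m,
        ((1 / 2 : ℝ) * K.R i j σ ν z) • wedge (om1 i σ z) (om1 j ν z)

/-- `P_{σν}` of the fundamental form, on the second jet prolongation. -/
def fundP (L : JetCoords m 2 → ℝ) (σ ν : Fin m) : JetCoords m 2 → ℝ := fun z =>
  (1 / 2 : ℝ) * (dY1 0 σ (dY1 1 ν L) z - dY1 0 ν (dY1 1 σ L) z)
    + cutD 0 (fun w => dY1 0 ν (dY2 0 1 σ L) w - dY1 0 σ (dY2 0 1 ν L) w) z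
    + cutD 1 (fun w => dY1 1 σ (dY2 0 1 ν L) w - dY1 1 ν (dY2 0 1 σ L) w) z

/-- `Q^1_{σ,ν}` and `Q^2_{σ,ν}` of the fundamental form, on the second jet prolongation. -/
def fundQ (L : JetCoords m 2 → ℝ) (j : Fin 2) (σ ν : Fin m) : JetCoords m 2 → ℝ := fun z =>
  if j = 0 then
    2 * dY1 0 σ (dY2 0 1 ν L) z - dY1 0 ν (dY2 0 1 σ L) z - dY1 1 ν (dY2 0 0 σ L) z
      - 2 * cutD 1 (dY2 0 1 σ (dY2 0 1 ν L)) z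
  else
    -2 * dY1 1 σ (dY2 0 1 ν L) z + dY1 0 ν (dY2 1 1 σ L) z + dY1 1 ν (dY2 0 1 σ L) z
      + 2 * cutD 0 (dY2 0 1 σ (dY2 0 1 ν L)) z

/-- `R^{i,j}_{σ,ν}` of the fundamental form, on the second jet prolongation. -/
def fundR (L : JetCoords m 2 → ℝ) (i j : Fin 2) (σ ν : Fin m) : JetCoords m 2 → ℝ := fun z =>
  if i = j then 0
  else if i = 0 then -2 * dY2 0 1 σ (dY2 0 1 ν L) z
  else 2 * dY2 0 1 σ (dY2 0 1 ν L) z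

/-- The coefficients of the fundamental form, pulled back to the third jet prolongation. -/
def fundCoeffs (L : JetCoords m 2 → ℝ) : Coeffs m where
  P σ ν := fun z => fundP L σ ν (proj z)
  Q j σ ν := fun z => fundQ L j σ ν (proj z)
  R i j σ ν := fun z => fundR L i j σ ν (proj z)

end Coordinates

/-! ### Lagrangians -/

section Lagrangians

variable {m : ℕ} {X Y : Type*}
  [TopologicalSpace X] [ChartedSpace (EuclideanSpace ℝ (Fin 2)) X]
  [TopologicalSpace Y] [ChartedSpace (EuclideanSpace ℝ (Fin (2 + m))) Y]

/-- The image of `V^r` under the associated chart `ψ^r` on `J^r Y`. -/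
def FiberedChart.domain {π : Y → X} (c : FiberedChart (m := m) π) (r : ℕ) :
    Set (JetCoords m r) :=
  {p | (p.1, p.2 0 0) ∈ c.ψ.target}

/-- The associated coordinates `xⁱ(J^r_x γ) = xⁱ(x)`,
`y^σ_{j₁…j_k}(J^r_x γ) = D_{j₁} … D_{j_k} (y^σ γ φ⁻¹)(φ(x))`. -/
def FiberedChart.coords {π : Y → X} (c : FiberedChart (m := m) π) (r : ℕ)
    (s : PointedSection (m := m) π) : JetCoords m r :=
  (c.φ s.base, fun k l σ =>
    iteratedFDeriv ℝ (k : ℕ) (c.rep s) (c.φ s.base)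
      (fun a => Pi.single (if (a : ℕ) + (l : ℕ) < (k : ℕ) then 0 else 1) 1) σ)

/-- `λ = L dx¹ ∧ dx²` on `V²`, with `L` smooth, for a family `form` of 2-forms on the tangent
spaces of the base, indexed by the points of `J² Y`. -/
def FiberedChart.IsExpression {π : Y → X} (c : FiberedChart (m := m) π)
    (form : (j : Jet m π 2) → TangentSpace (𝓡 2) j.base [⋀^Fin 2]→L[ℝ] ℝ)
    (L : JetCoords m 2 → ℝ) : Prop :=
  ContDiffOn ℝ ∞ L (c.domain 2) ∧
    ∀ s : PointedSection (m := m) π, s.γ s.base ∈ c.ψ.source →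
      ∀ v : Fin 2 → TangentSpace (𝓡 2) s.base,
        form (s.jet 2) v = L (c.coords 2 s) *
          Matrix.det (fun a b : Fin 2 =>
            (mfderiv (𝓡 2) 𝓘(ℝ, Fin 2 → ℝ) c.φ s.base (v b) : Fin 2 → ℝ) a)

/-- A second-order Lagrangian: a smooth horizontal 2-form on `J² Y`. A horizontal form at a jet
is the pullback of a unique 2-form on the tangent space of the base at the source of the jet. -/
structure Lagrangian (m : ℕ) {X Y : Type*}
    [TopologicalSpace X] [ChartedSpace (EuclideanSpace ℝ (Fin 2)) X]
    [TopologicalSpace Y] [ChartedSpace (EuclideanSpace ℝ (Fin (2 + m))) Y] (π : Y → X) where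
  form : (j : Jet m π 2) → TangentSpace (𝓡 2) j.base [⋀^Fin 2]→L[ℝ] ℝ
  smooth : ∀ c : FiberedChart (m := m) π, ∃ L, c.IsExpression form L

/-- `L` is the Lagrange function associated with the Lagrangian and the chart. -/
def Lagrangian.IsLagrangeFunction {π : Y → X} (lam : Lagrangian m π)
    (c : FiberedChart (m := m) π) (L : JetCoords m 2 → ℝ) : Prop :=
  c.IsExpression lam.form L

/-- The order-reducibility condition holds in every fibered chart. -/
def Lagrangian.OrderReducible {π : Y → X} (lam : Lagrangian m π) : Prop :=
  ∀ (c : FiberedChart (m := m) π) (L : JetCoords m 2 → ℝ), lam.IsLagrangeFunction c L →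
    ∀ z ∈ c.domain 2, OrderConditionAt L z

/-- Variational triviality: the Euler–Lagrange form vanishes identically on `J⁴ Y`. -/
def Lagrangian.IsTrivial {π : Y → X} (lam : Lagrangian m π) : Prop :=
  ∀ (c : FiberedChart (m := m) π) (L : JetCoords m 2 → ℝ), lam.IsLagrangeFunction c L →
    ∀ z ∈ c.domain 4, ∀ σ, eulerLagrange L σ z = 0

/-- A 2-form on `V³`, in coordinates, is closed. -/
def FiberedChart.IsClosedForm {π : Y → X} (c : FiberedChart (m := m) π)
    (η : JetCoords m 3 → JetCoords m 3 [⋀^Fin 2]→L[ℝ] ℝ) : Prop :=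
  ∀ z ∈ c.domain 3, extDeriv η z = 0

end Lagrangians

end FundLepage

end

open scoped Manifold ContDiff
open FundLepage

/-!
The form `Z_λ` is studied through its values on the frame formed by the cut formal derivatives
`d'_1`, `d'_2` and the vertical coordinate fields. These fields are affine in the jet coordinates
and satisfy `[d'_1, d'_2] = 0` and `[∂/∂y^σ_{Ji}, d'_i] = ∂/∂y^σ_J`, so a closed form
annihilated by `d'_i` and by the vertical fields of highest order is annihilated by all the vertical
ones.

For the coefficients `(*)`, the 3-form `ρ = dZ_λ` vanishes on `d'_1 ∧ d'_2` by the Lepage property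
and the Euler-Lagrange equations, is annihilated by the vertical fields of order three, and has a
few further vanishing components which amount to the definitions of `P`, `Q` and `R`. All the
remaining components of `ρ` vanish because of `dρ = 0` and the brackets above.

For uniqueness, the difference of two such forms with the same exterior derivative is a closed form
annihilated by `d'_1`, `d'_2` and the vertical fields of order three, hence it vanishes.
-/

noncomputable section

namespace FundLepage

section Cartan

open scoped Topology
open VectorField

variable {𝕜 E F : Type*} [NontriviallyNormedField 𝕜] [NormedAddCommGroup E] [NormedSpace 𝕜 E]
  [NormedAddCommGroup F] [NormedSpace 𝕜 F] {n : ℕ}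

theorem form_swap (η : E [⋀^Fin (n + 2)]→L[𝕜] F) (a b : E) (v : Fin n → E) :
    η (Matrix.vecCons a (Matrix.vecCons b v)) = -η (Matrix.vecCons b (Matrix.vecCons a v)) := by
  have hperm : Matrix.vecCons a (Matrix.vecCons b v) =
      Matrix.vecCons b (Matrix.vecCons a v) ∘ Equiv.swap 0 1 := by
    funext i
    refine Fin.cases (by simp) (Fin.cases (by simp) fun i => ?_) i
    rw [Function.comp_apply, Equiv.swap_apply_of_ne_of_ne] <;> simp [Fin.ext_iff]
  rw [hperm]
  exact η.toAlternatingMap.map_swap _ zero_ne_one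

theorem form_swap_right (η : E [⋀^Fin (n + 3)]→L[𝕜] F) (a b c : E) (v : Fin n → E) :
    η (Matrix.vecCons a (Matrix.vecCons b (Matrix.vecCons c v))) =
      -η (Matrix.vecCons a (Matrix.vecCons c (Matrix.vecCons b v))) :=
  form_swap (η.curryLeft a) b c v

theorem form_neg_left (η : E [⋀^Fin (n + 1)]→L[𝕜] F) (a : E) (v : Fin n → E) :
    η (Matrix.vecCons (-a) v) = -η (Matrix.vecCons a v) :=
  DFunLike.congr_fun (map_neg η.curryLeft a) v

theorem form_zero_left (η : E [⋀^Fin (n + 1)]→L[𝕜] F) (v : Fin n → E) :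
    η (Matrix.vecCons 0 v) = 0 :=
  η.map_coord_zero 0 rfl

theorem form_eq_zero_of_curryLeft_eq_zero {η : E [⋀^Fin (n + 1)]→L[𝕜] F} {v : Fin (n + 1) → E}
    (i : Fin (n + 1)) (h : η.curryLeft (v i) = 0) : η v = 0 := by
  have hperm : η (v ∘ Equiv.swap 0 i) = 0 := by
    rw [← Matrix.cons_head_tail (v ∘ Equiv.swap 0 i), ← η.curryLeft_apply_apply]
    simp [Matrix.vecHead, h]
  exact (smul_eq_zero_iff_eq _).1
    ((η.toAlternatingMap.map_perm v (Equiv.swap 0 i)).symm.trans hperm)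

theorem lieBracket_const_right (X : E → E) (u z : E) :
    lieBracket 𝕜 X (fun _ => u) z = -fderiv 𝕜 X z u := by
  simp [lieBracket]

theorem lieBracket_const_const (u v z : E) :
    lieBracket 𝕜 (fun _ => u) (fun _ => v) z = 0 := by
  simp [lieBracket]

theorem curryLeft_lieBracket_eq_zero {η : E → E [⋀^Fin (n + 1)]→L[𝕜] F} {X Y : E → E} {z : E}
    (hη : DifferentiableAt 𝕜 η z) (hd : extDeriv η z = 0)
    (hX : DifferentiableAt 𝕜 X z) (hY : DifferentiableAt 𝕜 Y z)
    (hXη : ∀ᶠ w in 𝓝 z, (η w).curryLeft (X w) = 0)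
    (hYη : ∀ᶠ w in 𝓝 z, (η w).curryLeft (Y w) = 0) :
    (η z).curryLeft (lieBracket 𝕜 X Y z) = 0 := by
  ext v
  set V : Fin (n + 2) → E → E := Fin.cons X (Fin.cons Y fun i _ => v i) with hVdef
  have hV : ∀ i, DifferentiableAt 𝕜 (V i) z :=
    Fin.cases hX (Fin.cases hY fun i => differentiableAt_const _)
  have hfun (i : Fin (n + 2)) :
      fderiv 𝕜 (fun w => η w (i.removeNth (V · w))) z = 0 := by
    have : (fun w => η w (i.removeNth (V · w))) =ᶠ[𝓝 z] fun _ => 0 := by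
      filter_upwards [hXη, hYη] with w hXw hYw
      refine form_eq_zero_of_curryLeft_eq_zero 0 ?_
      cases i using Fin.cases with
      | zero => exact hYw
      | succ i => exact hXw
    rw [this.fderiv_eq, fderiv_const_apply]
  have hbracket (i j : Fin (n + 1)) (hle : i ≤ j) (hj : j ≠ 0) (u : E) :
      η z (Matrix.vecCons u (j.removeNth (i.castSucc.removeNth (V · z)))) = 0 := by
    cases n with
    | zero => exact absurd (Fin.fin_one_eq_zero j) hj
    | succ n =>
      obtain ⟨j, rfl⟩ := Fin.exists_succ_eq.2 hj
      refine form_eq_zero_of_curryLeft_eq_zero 1 ?_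
      cases i using Fin.cases with
      | zero => exact hYη.self_of_nhds
      | succ i => exact hXη.self_of_nhds
  have key := extDeriv_apply_vectorField hη hV
  rw [hd, ContinuousAlternatingMap.coe_zero, Pi.zero_apply,
    Finset.sum_eq_zero fun i _ => by rw [hfun, zero_apply, smul_zero], zero_sub, eq_comm,
    neg_eq_zero, Finset.sum_eq_single_of_mem 0 (Finset.mem_univ _),
    Finset.sum_eq_single_of_mem 0 (by simp)] at key
  · simp only [Fin.val_zero, add_zero, pow_zero, one_smul] at key
    exact key
  · exact fun j _ hj0 => by rw [hbracket 0 j (by simp) hj0, smul_zero]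
  · refine fun i _ hi => Finset.sum_eq_zero fun j hj => ?_
    have hij : i ≤ j := by simpa using hj
    rw [hbracket i j hij fun h => hi (Fin.le_zero_iff.1 (h ▸ hij)), smul_zero]

theorem extDeriv_two_apply {η : E → E [⋀^Fin 2]→L[𝕜] F} {z : E} {X Y Z : E → E}
    (hη : DifferentiableAt 𝕜 η z) (hX : DifferentiableAt 𝕜 X z) (hY : DifferentiableAt 𝕜 Y z)
    (hZ : DifferentiableAt 𝕜 Z z) :
    extDeriv η z ![X z, Y z, Z z] =
      fderiv 𝕜 (fun w => η w ![Y w, Z w]) z (X z) - fderiv 𝕜 (fun w => η w ![X w, Z w]) z (Y z)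
        + fderiv 𝕜 (fun w => η w ![X w, Y w]) z (Z z)
        - η z ![lieBracket 𝕜 X Y z, Z z] + η z ![lieBracket 𝕜 X Z z, Y z]
        - η z ![lieBracket 𝕜 Y Z z, X z] := by
  set V : Fin 3 → E → E := ![X, Y, Z]
  have hV : ∀ i, DifferentiableAt 𝕜 (V i) z := by simp [V, Fin.forall_fin_succ, *]
  have hV3 : (V · z) = ![X z, Y z, Z z] := by funext i; fin_cases i <;> rfl
  have h0 w : Fin.removeNth 0 (V · w) = ![Y w, Z w] := by funext i; fin_cases i <;> rfl
  have h1 w : Fin.removeNth 1 (V · w) = ![X w, Z w] := by funext i; fin_cases i <;> rfl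
  have h2 w : Fin.removeNth 2 (V · w) = ![X w, Y w] := by funext i; fin_cases i <;> rfl
  have h01 : Fin.removeNth 0 ![Y z, Z z] = ![Z z] := by funext i; fin_cases i; rfl
  have h02 : Fin.removeNth 1 ![Y z, Z z] = ![Y z] := by funext i; fin_cases i; rfl
  have h12 : Fin.removeNth 1 ![X z, Z z] = ![X z] := by funext i; fin_cases i; rfl
  have key := extDeriv_apply_vectorField hη hV
  rw [Fin.sum_univ_three, Fin.sum_univ_two, show Finset.Ici (0 : Fin 2) = {0, 1} from rfl,
    show Finset.Ici (1 : Fin 2) = {1} from rfl, Finset.sum_pair (by decide), Finset.sum_singleton,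
    Fin.castSucc_zero, Fin.castSucc_one, h0, h1, hV3] at key
  simp only [h0, h1, h2, h01, h02, h12] at key
  rw [key]
  simp only [V, Fin.coe_ofNat_eq_mod, Nat.zero_mod, Nat.one_mod, Nat.mod_succ, Matrix.cons_val,
    Fin.succ_zero_eq_one, Fin.succ_one_eq_two, add_zero, zero_add, pow_zero, pow_one, even_two,
    Even.neg_pow, one_pow, one_smul, neg_smul]
  abel

theorem extDeriv_three_apply {η : E → E [⋀^Fin 3]→L[𝕜] F} {z : E} {W X Y Z : E → E}
    (hη : DifferentiableAt 𝕜 η z) (hW : DifferentiableAt 𝕜 W z) (hX : DifferentiableAt 𝕜 X z)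
    (hY : DifferentiableAt 𝕜 Y z) (hZ : DifferentiableAt 𝕜 Z z) :
    extDeriv η z ![W z, X z, Y z, Z z] =
      fderiv 𝕜 (fun w => η w ![X w, Y w, Z w]) z (W z)
        - fderiv 𝕜 (fun w => η w ![W w, Y w, Z w]) z (X z)
        + fderiv 𝕜 (fun w => η w ![W w, X w, Z w]) z (Y z)
        - fderiv 𝕜 (fun w => η w ![W w, X w, Y w]) z (Z z)
        - η z ![lieBracket 𝕜 W X z, Y z, Z z] + η z ![lieBracket 𝕜 W Y z, X z, Z z]
        - η z ![lieBracket 𝕜 W Z z, X z, Y z] - η z ![lieBracket 𝕜 X Y z, W z, Z z]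
        + η z ![lieBracket 𝕜 X Z z, W z, Y z] - η z ![lieBracket 𝕜 Y Z z, W z, X z] := by
  set V : Fin 4 → E → E := ![W, X, Y, Z]
  have hV : ∀ i, DifferentiableAt 𝕜 (V i) z := by simp [V, Fin.forall_fin_succ, *]
  have hVz : (V · z) = ![W z, X z, Y z, Z z] := by funext i; fin_cases i <;> rfl
  have h0 w : Fin.removeNth 0 (V · w) = ![X w, Y w, Z w] := by funext i; fin_cases i <;> rfl
  have h1 w : Fin.removeNth 1 (V · w) = ![W w, Y w, Z w] := by funext i; fin_cases i <;> rfl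
  have h2 w : Fin.removeNth 2 (V · w) = ![W w, X w, Z w] := by funext i; fin_cases i <;> rfl
  have h3 w : Fin.removeNth 3 (V · w) = ![W w, X w, Y w] := by funext i; fin_cases i <;> rfl
  have r0 (a b c : E) : Fin.removeNth 0 ![a, b, c] = ![b, c] := by funext i; fin_cases i <;> rfl
  have r1 (a b c : E) : Fin.removeNth 1 ![a, b, c] = ![a, c] := by funext i; fin_cases i <;> rfl
  have r2 (a b c : E) : Fin.removeNth 2 ![a, b, c] = ![a, b] := by funext i; fin_cases i <;> rfl
  have key := extDeriv_apply_vectorField hη hV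
  rw [Fin.sum_univ_four, Fin.sum_univ_three, show Finset.Ici (0 : Fin 3) = {0, 1, 2} from rfl,
    show Finset.Ici (1 : Fin 3) = {1, 2} from rfl, show Finset.Ici (2 : Fin 3) = {2} from rfl,
    Finset.sum_insert (by decide), Finset.sum_pair (by decide), Finset.sum_pair (by decide),
    Finset.sum_singleton, Fin.castSucc_zero, Fin.castSucc_one,
    show Fin.castSucc (2 : Fin 3) = 2 from rfl] at key
  simp only [h0, h1, h2, h3, r0, r1, r2] at key
  rw [hVz] at key
  rw [key]
  simp only [V, Fin.coe_ofNat_eq_mod, Nat.zero_mod, Nat.one_mod, Nat.mod_succ, Nat.reduceMod,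
    Nat.reduceAdd, Matrix.cons_val, Fin.succ_zero_eq_one, Fin.succ_one_eq_two, Fin.reduceSucc,
    add_zero, zero_add, pow_zero, pow_one, even_two, Even.neg_pow, one_pow, Int.reducePow,
    Int.reduceNeg, one_smul, neg_smul]
  abel

theorem form_three_fderiv_exchange {η : E → E [⋀^Fin 3]→L[𝕜] F} {z : E} {X Y : E → E} {u v : E}
    (hη : DifferentiableAt 𝕜 η z) (hd : extDeriv η z = 0) (hX : DifferentiableAt 𝕜 X z)
    (hY : DifferentiableAt 𝕜 Y z) (hcomm : lieBracket 𝕜 X Y z = 0)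
    (hXY : ∀ᶠ w in 𝓝 z, ∀ a, η w ![X w, Y w, a] = 0)
    (hXuv : ∀ᶠ w in 𝓝 z, η w ![X w, u, v] = 0) (hYuv : ∀ᶠ w in 𝓝 z, η w ![Y w, u, v] = 0) :
    η z ![Y z, fderiv 𝕜 X z u, v] + η z ![Y z, u, fderiv 𝕜 X z v] =
      η z ![X z, fderiv 𝕜 Y z u, v] + η z ![X z, u, fderiv 𝕜 Y z v] := by
  have key := extDeriv_three_apply hη hX hY (differentiableAt_const u) (differentiableAt_const v)
  have hfderiv {f : E → F} (hf : ∀ᶠ w in 𝓝 z, f w = 0) : fderiv 𝕜 f z = 0 := by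
    rw [Filter.EventuallyEq.fderiv_eq (f := fun _ => (0 : F)) hf, fderiv_const_apply]
  simp only [hd, hcomm, hfderiv hXuv, hfderiv hYuv, hfderiv (hXY.mono fun _ h => h _),
    lieBracket_const_right, fderiv_fun_const, ContinuousAlternatingMap.coe_zero, Pi.zero_apply,
    zero_apply, form_zero_left, form_neg_left, neg_zero, sub_zero, add_zero, zero_add] at key
  rw [form_swap _ _ (Y z) ![v], form_swap _ _ (Y z) ![u], form_swap _ _ (X z) ![v],
    form_swap _ _ (X z) ![u], form_swap_right _ (Y z) _ u, form_swap_right _ (X z) _ u] at key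
  rw [← sub_eq_zero, key]
  abel

end Cartan

section SmoothFunctions

open TopologicalSpace (Opens)

variable {E : Type*} [NormedAddCommGroup E] [NormedSpace ℝ E]

/-- The module of smooth real functions on an open set `D`, encoded as functions on the whole space
that are smooth on `D` and zero outside `D`, so that equality of elements is equality on `D`. -/
def smoothFn (D : Opens E) : Submodule ℝ (E → ℝ) where
  carrier := {f | ContDiffOn ℝ ∞ f D ∧ ∀ z ∉ D, f z = 0}
  add_mem' hf hg := ⟨hf.1.add hg.1, fun z hz => by simp [hf.2 z hz, hg.2 z hz]⟩
  zero_mem' := ⟨contDiffOn_const, fun _ _ => rfl⟩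
  smul_mem' c f hf := ⟨contDiffOn_const.smul hf.1, fun z hz => by simp [hf.2 z hz]⟩

variable {D : Opens E}

@[ext] theorem smoothFn.ext {f g : smoothFn D} (h : ∀ z ∈ D, f.1 z = g.1 z) : f = g := by
  apply Subtype.ext
  funext z
  by_cases hz : z ∈ D
  · exact h z hz
  · rw [f.2.2 z hz, g.2.2 z hz]

theorem contDiffAt_smoothFn (f : smoothFn D) {z : E} (hz : z ∈ D) : ContDiffAt ℝ ∞ f.1 z :=
  f.2.1.contDiffAt (D.isOpen.mem_nhds hz)

theorem differentiableAt_smoothFn (f : smoothFn D) {z : E} (hz : z ∈ D) :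
    DifferentiableAt ℝ f.1 z :=
  (contDiffAt_smoothFn f hz).differentiableAt (by simp)

/-- The element of `smoothFn D` given by a function that is smooth on `D`. -/
def restr (f : E → ℝ) (hf : ContDiffOn ℝ ∞ f D) : smoothFn D :=
  ⟨(D : Set E).indicator f, hf.congr fun _ hz => Set.indicator_of_mem hz f,
    fun _ hz => Set.indicator_of_notMem hz f⟩

theorem restr_apply {f : E → ℝ} (hf : ContDiffOn ℝ ∞ f D) {z : E} (hz : z ∈ D) :
    (restr f hf).1 z = f z :=
  Set.indicator_of_mem hz f

theorem contDiffOn_fderiv_apply {f : E → ℝ} {X : E → E} (hf : ContDiffOn ℝ ∞ f D)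
    (hX : ContDiffOn ℝ ∞ X D) : ContDiffOn ℝ ∞ (fun z => fderiv ℝ f z (X z)) D :=
  (hf.fderiv_of_isOpen D.isOpen (by simp)).clm_apply hX

/-- The affine vector field with value `e` at the origin and linear part `N`. Both the formal
derivatives and the vertical coordinate derivatives are derivatives along such fields, which are
closed under brackets. -/
def affineField (e : E) (N : E →L[ℝ] E) (z : E) : E := e + N z

@[simp] theorem affineField_zero (e z : E) : affineField e 0 z = e := by simp [affineField]

theorem hasFDerivAt_affineField (e : E) (N : E →L[ℝ] E) (z : E) :
    HasFDerivAt (affineField e N) N z :=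
  N.hasFDerivAt.const_add e

theorem contDiff_affineField (e : E) (N : E →L[ℝ] E) : ContDiff ℝ ∞ (affineField e N) :=
  contDiff_const.add N.contDiff

/-- The derivative along the affine vector field `affineField e N`. -/
def der (e : E) (N : E →L[ℝ] E) : smoothFn D →ₗ[ℝ] smoothFn D where
  toFun f := restr (fun z => fderiv ℝ f.1 z (affineField e N z))
    (contDiffOn_fderiv_apply f.2.1 (contDiff_affineField e N).contDiffOn)
  map_add' f g := by
    ext z hz
    have := fderiv_add (differentiableAt_smoothFn f hz) (differentiableAt_smoothFn g hz)
    simp [restr_apply _ hz, this]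
  map_smul' c f := by
    ext z hz
    have := fderiv_const_smul (differentiableAt_smoothFn f hz) c
    simp [restr_apply _ hz, this]

theorem der_apply {e : E} {N : E →L[ℝ] E} {f : smoothFn D} {g : E → ℝ} {z : E}
    (h : Set.EqOn f.1 g D) (hz : z ∈ D) :
    (der e N f).1 z = fderiv ℝ g z (affineField e N z) := by
  have hder : (der e N f).1 z = fderiv ℝ f.1 z (affineField e N z) :=
    restr_apply (contDiffOn_fderiv_apply f.2.1 (contDiff_affineField e N).contDiffOn) hz
  rw [hder, (h.eventuallyEq_of_mem (D.isOpen.mem_nhds hz)).fderiv_eq]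

theorem der_zero_zero (f : smoothFn D) : der 0 0 f = 0 := by
  ext z hz
  rw [der_apply (fun _ _ => rfl) hz]
  simp

theorem der_der_apply (e e' : E) (N N' : E →L[ℝ] E) (f : smoothFn D) {z : E} (hz : z ∈ D) :
    (der e N (der e' N' f)).1 z =
      fderiv ℝ (fderiv ℝ f.1) z (affineField e N z) (affineField e' N' z) +
        fderiv ℝ f.1 z (N' (affineField e N z)) := by
  rw [der_apply (fun w hw => der_apply (fun _ _ => rfl) hw) hz]
  have hf : DifferentiableAt ℝ (fderiv ℝ f.1) z :=
    ((contDiffAt_smoothFn f hz).fderiv_right (m := ∞) (by simp)).differentiableAt (by simp)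
  rw [(hf.hasFDerivAt.clm_apply (hasFDerivAt_affineField e' N' z)).fderiv]
  simp [add_comm]

theorem minSmoothness_real_two_le_infty : minSmoothness ℝ 2 ≤ ∞ := by
  rw [minSmoothness_of_isRCLikeNormedField]
  exact WithTop.coe_le_coe.2 (le_top : (2 : ℕ∞) ≤ ⊤)

theorem der_comm (e e' : E) (N N' : E →L[ℝ] E) (f : smoothFn D) :
    der e N (der e' N' f) = der e' N' (der e N f) +
      der (N' e - N e') (N' ∘L N - N ∘L N') f := by
  ext z hz
  have hsymm : IsSymmSndFDerivAt ℝ f.1 z :=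
    (contDiffAt_smoothFn f hz).isSymmSndFDerivAt minSmoothness_real_two_le_infty
  rw [Submodule.coe_add, Pi.add_apply, der_der_apply _ _ _ _ _ hz, der_der_apply _ _ _ _ _ hz,
    der_apply (fun _ _ => rfl) hz, hsymm.eq, add_assoc, ← map_add]
  congr 2
  simp only [affineField, map_add, sub_apply, ContinuousLinearMap.comp_apply]
  abel

end SmoothFunctions

section Frame

open TopologicalSpace (Opens)
open VectorField

variable {m r n : ℕ} {F : Type*} [NormedAddCommGroup F] [NormedSpace ℝ F]

/-- The coordinate vector `∂/∂xⁱ`. -/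
def vecX (i : Fin 2) : JetCoords m r := (Pi.single i 1, 0)

/-- The vector `∂/∂y^σ_J` for `J` of length `k` with `l` entries `2`, zero if there is no such
coordinate. -/
def coordVec (k l : ℕ) (σ : Fin m) : JetCoords m r :=
  (0, fun k' l' τ => if (k' : ℕ) = k ∧ (l' : ℕ) = l ∧ τ = σ then 1 else 0)

theorem vecY_eq_coordVec (k l : ℕ) (hk : k < r + 1) (hl : l < k + 1) (σ : Fin m) :
    (vecY k l hk hl σ : JetCoords m r) = coordVec k l σ := by
  refine Prod.ext rfl ?_
  funext k' l' τ
  simp only [vecY, coordVec]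
  rcases eq_or_ne k' ⟨k, hk⟩ with rfl | hne
  · rw [Pi.single_eq_same]
    rcases eq_or_ne l' ⟨l, hl⟩ with rfl | hne
    · rw [Pi.single_eq_same]
      simp [Pi.single_apply]
    · rw [Pi.single_eq_of_ne hne]
      have : (l' : ℕ) ≠ l := fun h => hne (Fin.ext h)
      simp [this]
  · rw [Pi.single_eq_of_ne hne]
    have : (k' : ℕ) ≠ k := fun h => hne (Fin.ext h)
    simp [this]

theorem coordVec_eq_zero {k l : ℕ} (h : r < k ∨ k < l) (σ : Fin m) :
    (coordVec k l σ : JetCoords m r) = 0 := by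
  refine Prod.ext rfl ?_
  funext k' l' τ
  have h1 := k'.isLt
  have h2 := l'.isLt
  simp only [coordVec, Prod.snd_zero, Pi.zero_apply, ite_eq_right_iff]
  omega

/-- The linear part of the vector field `cutVec i`. -/
def shift (i : Fin 2) : JetCoords m r →L[ℝ] JetCoords m r :=
  LinearMap.toContinuousLinearMap
    { toFun := fun p => (0, (cutVec i p).2)
      map_add' := fun p q => by
        refine Prod.ext (by simp) ?_
        funext k l σ
        by_cases h : (k : ℕ) < r <;> simp [cutVec, h]
      map_smul' := fun c p => by
        refine Prod.ext (by simp) ?_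
        funext k l σ
        by_cases h : (k : ℕ) < r <;> simp [cutVec, h] }

theorem shift_apply (i : Fin 2) (p : JetCoords m r) : shift i p = (0, (cutVec i p).2) := rfl

theorem cutVec_eq_affineField (i : Fin 2) (p : JetCoords m r) :
    cutVec i p = affineField (vecX i) (shift i) p :=
  Prod.ext (by simp [cutVec, affineField, vecX, shift_apply])
    (by simp [affineField, vecX, shift_apply])

theorem shift_vecX (i j : Fin 2) : shift i (vecX j : JetCoords m r) = 0 := by
  rw [shift_apply]
  refine Prod.ext rfl ?_
  funext k l σ
  simp [cutVec, vecX]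

theorem shift_shift (i j : Fin 2) (p : JetCoords m r) :
    shift i (shift j p) = shift j (shift i p) := by
  refine Prod.ext rfl ?_
  funext k l σ
  by_cases h : (k : ℕ) < r
  · by_cases h' : (k : ℕ) + 1 < r
    · simp [shift_apply, cutVec, h, h', add_assoc, add_comm (i : ℕ)]
    · simp [shift_apply, cutVec, h, h']
  · simp [shift_apply, cutVec, h]

theorem shift_coordVec (i : Fin 2) {k l : ℕ} (hk : k < r) (σ : Fin m) :
    shift i (coordVec (k + 1) (l + i) σ : JetCoords m r) = coordVec k l σ := by
  refine Prod.ext rfl ?_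
  funext k' l' τ
  by_cases h : (k' : ℕ) < r
  · simp [shift_apply, cutVec, h, coordVec]
  · have : (k' : ℕ) ≠ k := by omega
    simp [shift_apply, cutVec, h, coordVec, this]

theorem shift_coordVec_of_lt (i : Fin 2) {k l : ℕ} (h : k = 0 ∨ l < i) (σ : Fin m) :
    shift i (coordVec k l σ : JetCoords m r) = 0 := by
  refine Prod.ext rfl ?_
  funext k' l' τ
  by_cases h' : (k' : ℕ) < r
  · simp only [shift_apply, cutVec, h', coordVec, dite_true, Prod.snd_zero, Pi.zero_apply,
      ite_eq_right_iff]
    omega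
  · simp [shift_apply, cutVec, h']

theorem eq_sum_coordVec (p : JetCoords m r) :
    p = p.1 0 • vecX 0 + p.1 1 • vecX 1 +
      ∑ k : Fin (r + 1), ∑ l : Fin ((k : ℕ) + 1), ∑ σ : Fin m, p.2 k l σ • coordVec k l σ := by
  refine Prod.ext ?_ ?_
  · funext i
    simp only [Prod.fst_add, Prod.fst_sum, Prod.smul_fst]
    fin_cases i <;> simp [vecX, coordVec]
  · funext k l σ
    simp only [Prod.snd_add, Prod.snd_sum, Prod.smul_snd, vecX, coordVec, smul_zero, zero_add,
      Finset.sum_apply, Pi.smul_apply, Pi.add_apply, Pi.zero_apply]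
    rw [Finset.sum_eq_single k, Finset.sum_eq_single l, Finset.sum_eq_single σ]
    · simp
    · intro τ _ h
      simp [h.symm]
    · simp
    · intro l' _ h
      have : (l : ℕ) ≠ l' := fun e => h (Fin.ext e.symm)
      simp [this]
    · simp
    · intro k' _ h
      have : (k : ℕ) ≠ k' := fun e => h (Fin.ext e.symm)
      simp [this]
    · simp

theorem linearMap_eq_zero_of_frame {M : Type*} [AddCommGroup M] [Module ℝ M] (z : JetCoords m r)
    (f : JetCoords m r →ₗ[ℝ] M) (hcut : ∀ i, f (cutVec i z) = 0)
    (hvert : ∀ k l σ, f (coordVec k l σ) = 0) : f = 0 := by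
  have hker (q : JetCoords m r) (hq : q.1 = 0) : f q = 0 := by
    rw [eq_sum_coordVec q]
    simp [hq, hvert]
  have hX (i : Fin 2) : f (vecX i) = 0 := by
    have h := hcut i
    rwa [cutVec_eq_affineField, affineField, map_add, hker (shift i z) rfl, add_zero] at h
  refine LinearMap.ext fun p => ?_
  rw [eq_sum_coordVec p]
  simp [hX, hvert]

theorem form_eq_zero_of_frame {z : JetCoords m r} {α : JetCoords m r [⋀^Fin (n + 1)]→L[ℝ] F}
    (hcut : ∀ i, α.curryLeft (cutVec i z) = 0) (hvert : ∀ k l σ, α.curryLeft (coordVec k l σ) = 0) :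
    α = 0 := by
  have h := linearMap_eq_zero_of_frame z α.curryLeft.toLinearMap hcut hvert
  exact ContinuousAlternatingMap.ext fun v =>
    form_eq_zero_of_curryLeft_eq_zero 0 (LinearMap.congr_fun h (v 0))

theorem form_eq_zero_of_cutVec_zero {z : JetCoords m r} {α : JetCoords m r [⋀^Fin (n + 2)]→L[ℝ] F}
    (hcut : α.curryLeft (cutVec 0 z) = 0) (hvert : ∀ k l σ, α.curryLeft (coordVec k l σ) = 0) :
    α = 0 := by
  have hcurry {u : JetCoords m r} (w : JetCoords m r) (h : α.curryLeft u = 0) :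
      (α.curryLeft w).curryLeft u = 0 :=
    ContinuousAlternatingMap.ext fun v =>
      form_eq_zero_of_curryLeft_eq_zero (v := Matrix.vecCons w (Matrix.vecCons u v)) 1 h
  refine form_eq_zero_of_frame (Fin.forall_fin_two.2 ⟨hcut, ?_⟩) hvert
  exact form_eq_zero_of_frame (Fin.forall_fin_two.2 ⟨hcurry _ hcut, α.curryLeft_same _⟩)
    fun k l σ => hcurry _ (hvert k l σ)

theorem hasFDerivAt_cutVec (i : Fin 2) (z : JetCoords m r) :
    HasFDerivAt (cutVec i) (shift i) z := by
  rw [funext (cutVec_eq_affineField i)]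
  exact hasFDerivAt_affineField _ _ z

theorem lieBracket_cutVec_cutVec (i j : Fin 2) (z : JetCoords m r) :
    lieBracket ℝ (cutVec i) (cutVec j) z = 0 := by
  rw [lieBracket, (hasFDerivAt_cutVec i z).fderiv, (hasFDerivAt_cutVec j z).fderiv,
    cutVec_eq_affineField, cutVec_eq_affineField, affineField, affineField, map_add, map_add,
    shift_vecX, shift_vecX, shift_shift, sub_self]

theorem lieBracket_cutVec_const (i : Fin 2) (u z : JetCoords m r) :
    lieBracket ℝ (cutVec i) (fun _ => u) z = -shift i u := by
  rw [lieBracket_const_right, (hasFDerivAt_cutVec i z).fderiv]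

/-- The open set of jet coordinates over an open set `T` of coordinates `(xⁱ, y^σ)`. -/
def jetDomain (T : Opens ((Fin 2 → ℝ) × (Fin m → ℝ))) (r : ℕ) : Opens (JetCoords m r) :=
  ⟨{p | (p.1, p.2 0 0) ∈ T}, T.isOpen.preimage (by fun_prop)⟩

/-- `proj` as a continuous linear map. -/
def projL : JetCoords m (r + 1) →L[ℝ] JetCoords m r :=
  LinearMap.toContinuousLinearMap
    { toFun := proj
      map_add' := fun _ _ => rfl
      map_smul' := fun _ _ => rfl }

theorem proj_mem {T : Opens ((Fin 2 → ℝ) × (Fin m → ℝ))} {p : JetCoords m (r + 1)}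
    (hp : p ∈ jetDomain T (r + 1)) : proj p ∈ jetDomain T r := hp

theorem proj_coordVec (k l : ℕ) (σ : Fin m) :
    proj (coordVec k l σ : JetCoords m (r + 1)) = coordVec k l σ := rfl

theorem proj_cutVec (i : Fin 2) (p : JetCoords m (r + 1)) : proj (cutVec i p) = formalVec i p := by
  refine Prod.ext rfl ?_
  funext k l σ
  have : (k : ℕ) < r + 1 := k.isLt
  simp only [proj, cutVec, formalVec, Fin.val_castSucc, this, dite_true]
  rfl

theorem formalVec_eq_cutVec_add (i : Fin 2) (p : JetCoords m (r + 1)) :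
    formalVec i p = cutVec i (proj p) + ∑ l : Fin (r + 1), ∑ σ : Fin m,
      p.2 (Fin.last (r + 1)) ⟨(l : ℕ) + i, by simp; omega⟩ σ • coordVec r l σ := by
  refine Prod.ext ?_ ?_
  · simp [formalVec, cutVec, Prod.fst_sum, coordVec]
  · funext k l σ
    simp only [Prod.snd_add, Prod.snd_sum, Prod.smul_snd, coordVec,
      Finset.sum_apply, Pi.smul_apply, Pi.add_apply]
    by_cases hk : (k : ℕ) < r
    · have : (k : ℕ) ≠ r := by omega
      simp only [formalVec, Fin.val_succ, cutVec, proj, hk, ↓reduceDIte, Fin.val_last, this,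
        false_and, ↓reduceIte, smul_eq_mul, mul_zero, Finset.sum_const_zero, add_zero]
      rfl
    · obtain rfl : k = Fin.last r := Fin.ext (by simp; omega)
      rw [Finset.sum_eq_single (Fin.cast (by simp) l), Finset.sum_eq_single σ]
      · simp [formalVec, cutVec]
      · intro τ _ h
        simp [h.symm]
      · simp
      · intro l' _ h
        have : (l : ℕ) ≠ l' := fun e => h (Fin.ext e.symm)
        simp [this]
      · simp

variable {T : Opens ((Fin 2 → ℝ) × (Fin m → ℝ))}

theorem form_eq_zero_of_extDeriv_eq_zero
    {η : JetCoords m r → JetCoords m r [⋀^Fin (n + 2)]→L[ℝ] F}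
    (hη : ∀ z ∈ jetDomain T r, DifferentiableAt ℝ η z)
    (hd : ∀ z ∈ jetDomain T r, extDeriv η z = 0)
    (hcut : ∀ z ∈ jetDomain T r, (η z).curryLeft (cutVec 0 z) = 0)
    (htop : ∀ z ∈ jetDomain T r, ∀ l σ, (η z).curryLeft (coordVec r l σ) = 0) :
    ∀ z ∈ jetDomain T r, η z = 0 := by
  have hvert (k : ℕ) (hk : k ≤ r) :
      ∀ z ∈ jetDomain T r, ∀ l σ, (η z).curryLeft (coordVec k l σ) = 0 := by
    induction hk using Nat.decreasingInduction with
    | self => exact htop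
    | of_succ k hk ih =>
      intro z hz l σ
      have hnhds := (jetDomain T r).isOpen.mem_nhds hz
      have h := curryLeft_lieBracket_eq_zero (hη z hz) (hd z hz)
        (hasFDerivAt_cutVec 0 z).differentiableAt
        (differentiableAt_const (coordVec (k + 1) l σ : JetCoords m r))
        (Filter.eventually_of_mem hnhds hcut)
        (Filter.eventually_of_mem hnhds fun w hw => ih w hw l σ)
      have hshift := shift_coordVec (r := r) (l := l) 0 (by omega : k < r) σ
      rw [Fin.val_zero, add_zero] at hshift
      rwa [lieBracket_cutVec_const, hshift, map_neg, neg_eq_zero] at h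
  refine fun z hz => form_eq_zero_of_cutVec_zero (hcut z hz) fun k l σ => ?_
  rcases le_or_gt k r with hk | hk
  · exact hvert k hk z hz l σ
  · rw [coordVec_eq_zero (Or.inl hk), map_zero]

end Frame

section JetFunctions

open TopologicalSpace (Opens)

variable {m r : ℕ} {T : Opens ((Fin 2 → ℝ) × (Fin m → ℝ))}

/-- The derivative in the coordinate `y^σ_J`, for `J` of length `k` with `l` entries `2`. -/
def dVert (k l : ℕ) (σ : Fin m) : smoothFn (jetDomain T r) →ₗ[ℝ] smoothFn (jetDomain T r) :=
  der (coordVec k l σ) 0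

/-- The cut formal derivative `d'_i` on smooth functions of order `r`. -/
def dCut (i : Fin 2) : smoothFn (jetDomain T r) →ₗ[ℝ] smoothFn (jetDomain T r) :=
  der (vecX i) (shift i)

theorem dVert_apply {k l : ℕ} {σ : Fin m} {f : smoothFn (jetDomain T r)} {g : JetCoords m r → ℝ}
    {z : JetCoords m r} (h : Set.EqOn f.1 g (jetDomain T r)) (hz : z ∈ jetDomain T r) :
    (dVert k l σ f).1 z = fderiv ℝ g z (coordVec k l σ) := by
  rw [dVert, der_apply h hz, affineField_zero]

theorem dCut_apply {i : Fin 2} {f : smoothFn (jetDomain T r)} {g : JetCoords m r → ℝ}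
    {z : JetCoords m r} (h : Set.EqOn f.1 g (jetDomain T r)) (hz : z ∈ jetDomain T r) :
    (dCut i f).1 z = fderiv ℝ g z (cutVec i z) := by
  rw [dCut, der_apply h hz, cutVec_eq_affineField]

theorem dVert_eq_zero {k l : ℕ} (h : k < l) (σ : Fin m) (f : smoothFn (jetDomain T r)) :
    dVert k l σ f = 0 := by
  rw [dVert, coordVec_eq_zero (Or.inr h), der_zero_zero]

theorem dVert_comm (k l k' l' : ℕ) (σ ν : Fin m) (f : smoothFn (jetDomain T r)) :
    dVert k l σ (dVert k' l' ν f) = dVert k' l' ν (dVert k l σ f) := by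
  rw [dVert, dVert, der_comm]
  simp [der_zero_zero]

theorem dVert_dCut (i : Fin 2) {k : ℕ} (hk : k < r) (l : ℕ) (σ : Fin m)
    (f : smoothFn (jetDomain T r)) :
    dVert (k + 1) (l + i) σ (dCut i f) = dCut i (dVert (k + 1) (l + i) σ f) + dVert k l σ f := by
  rw [dVert, dCut, der_comm, shift_coordVec i hk]
  simp [dVert]

theorem dVert_dCut_of_lt (i : Fin 2) {k l : ℕ} (h : k = 0 ∨ l < i) (σ : Fin m)
    (f : smoothFn (jetDomain T r)) :
    dVert k l σ (dCut i f) = dCut i (dVert k l σ f) := by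
  rw [dVert, dCut, der_comm, shift_coordVec_of_lt i h]
  simp [der_zero_zero]

theorem contDiffOn_comp_proj {f : JetCoords m r → ℝ} (hf : ContDiffOn ℝ ∞ f (jetDomain T r)) :
    ContDiffOn ℝ ∞ (fun z => f (proj z)) (jetDomain T (r + 1)) :=
  hf.comp projL.contDiff.contDiffOn fun _ h => h

theorem contDiffOn_cutD {f : JetCoords m r → ℝ} (hf : ContDiffOn ℝ ∞ f (jetDomain T r))
    (i : Fin 2) : ContDiffOn ℝ ∞ (cutD i f) (jetDomain T r) := by
  refine contDiffOn_fderiv_apply hf ?_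
  simp only [funext (cutVec_eq_affineField i)]
  exact (contDiff_affineField _ _).contDiffOn

/-- `a` is the pullback to `J^{r+1} Y` of the smooth function `f` of order `r`. -/
def IsPullback (a : smoothFn (jetDomain T (r + 1))) (f : JetCoords m r → ℝ) : Prop :=
  ContDiffOn ℝ ∞ f (jetDomain T r) ∧ ∀ z ∈ jetDomain T (r + 1), a.1 z = f (proj z)

theorem exists_isPullback {f : JetCoords m r → ℝ} (hf : ContDiffOn ℝ ∞ f (jetDomain T r)) :
    ∃ a : smoothFn (jetDomain T (r + 1)), IsPullback a f :=
  ⟨restr (fun z => f (proj z)) (contDiffOn_comp_proj hf), hf, fun _ hz => restr_apply _ hz⟩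

namespace IsPullback

variable {a b : smoothFn (jetDomain T (r + 1))} {f g : JetCoords m r → ℝ}

theorem add (ha : IsPullback a f) (hb : IsPullback b g) :
    IsPullback (a + b) (fun z => f z + g z) :=
  ⟨ha.1.add hb.1, fun z hz => by simp [ha.2 z hz, hb.2 z hz]⟩

theorem sub (ha : IsPullback a f) (hb : IsPullback b g) :
    IsPullback (a - b) (fun z => f z - g z) :=
  ⟨ha.1.sub hb.1, fun z hz => by simp [ha.2 z hz, hb.2 z hz]⟩

theorem smul (c : ℝ) (ha : IsPullback a f) : IsPullback (c • a) (fun z => c * f z) :=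
  ⟨contDiffOn_const.mul ha.1, fun z hz => by simp [ha.2 z hz]⟩

theorem der_eq (ha : IsPullback a f) {z : JetCoords m (r + 1)} (hz : z ∈ jetDomain T (r + 1))
    (e : JetCoords m (r + 1)) (N : JetCoords m (r + 1) →L[ℝ] JetCoords m (r + 1)) :
    (der e N a).1 z = fderiv ℝ f (proj z) (proj (affineField e N z)) := by
  rw [der_apply (fun w hw => ha.2 w hw) hz]
  have hf : DifferentiableAt ℝ f (projL z) :=
    (ha.1.contDiffAt ((jetDomain T r).isOpen.mem_nhds (proj_mem hz))).differentiableAt (by simp)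
  exact congrArg (fun φ : JetCoords m (r + 1) →L[ℝ] ℝ => φ (affineField e N z))
    (hf.hasFDerivAt.comp z projL.hasFDerivAt).fderiv

theorem vert (ha : IsPullback a f) (k l : ℕ) (σ : Fin m) :
    IsPullback (dVert k l σ a) (fun p => fderiv ℝ f p (coordVec k l σ)) :=
  ⟨contDiffOn_fderiv_apply ha.1 contDiffOn_const, fun z hz => by
    rw [dVert, ha.der_eq hz, affineField_zero, proj_coordVec]⟩

theorem vert_top (ha : IsPullback a f) (l : ℕ) (σ : Fin m) : dVert (r + 1) l σ a = 0 := by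
  ext z hz
  simp [(ha.vert (r + 1) l σ).2 z hz, coordVec_eq_zero (r := r) (Or.inl r.lt_succ_self)]

theorem cut_apply (ha : IsPullback a f) (i : Fin 2) {z : JetCoords m (r + 1)}
    (hz : z ∈ jetDomain T (r + 1)) : (dCut i a).1 z = formalD i f z := by
  rw [dCut, ha.der_eq hz, ← cutVec_eq_affineField, proj_cutVec, formalD]

theorem cut (ha : IsPullback a f) (h : ∀ l σ, dVert r l σ a = 0) (i : Fin 2) :
    IsPullback (dCut i a) (cutD i f) := by
  refine ⟨contDiffOn_cutD ha.1 i, fun z hz => ?_⟩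
  have hf (l : ℕ) (σ : Fin m) : fderiv ℝ f (proj z) (coordVec r l σ) = 0 := by
    have hv := (ha.vert r l σ).2 z hz
    rw [h] at hv
    exact hv.symm
  rw [ha.cut_apply i hz, formalD, formalVec_eq_cutVec_add, map_add, map_sum]
  simp [hf, cutD]

end IsPullback

end JetFunctions

section Identities

open TopologicalSpace (Opens)

variable {m : ℕ} {T : Opens ((Fin 2 → ℝ) × (Fin m → ℝ))} {F : smoothFn (jetDomain T 3)}

theorem dVert_dCut_zero {k : ℕ} (hk : k < 3) (l : ℕ) (σ : Fin m) (f : smoothFn (jetDomain T 3)) :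
    dVert (k + 1) l σ (dCut 0 f) = dCut 0 (dVert (k + 1) l σ f) + dVert k l σ f :=
  dVert_dCut 0 hk l σ f

theorem dVert_dCut_one {k : ℕ} (hk : k < 3) (l : ℕ) (σ : Fin m) (f : smoothFn (jetDomain T 3)) :
    dVert (k + 1) (l + 1) σ (dCut 1 f) = dCut 1 (dVert (k + 1) (l + 1) σ f) + dVert k l σ f :=
  dVert_dCut 1 hk l σ f

theorem dVert_zero_dCut_one (k : ℕ) (σ : Fin m) (f : smoothFn (jetDomain T 3)) :
    dVert k 0 σ (dCut 1 f) = dCut 1 (dVert k 0 σ f) :=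
  dVert_dCut_of_lt 1 (Or.inr zero_lt_one) σ f

/-- The symmetrized derivative `∂/∂y^σ_{ij}`, which is one half of the coordinate derivative when
`i ≠ j`. -/
def dSymm (i j : Fin 2) (σ : Fin m) : smoothFn (jetDomain T 3) →ₗ[ℝ] smoothFn (jetDomain T 3) :=
  (if i = j then (1 : ℝ) else 1 / 2) • dVert 2 (i + j : ℕ) σ

theorem dSymm_symm (i j : Fin 2) (σ : Fin m) :
    (dSymm i j σ : smoothFn (jetDomain T 3) →ₗ[ℝ] _) = dSymm j i σ := by
  simp only [dSymm, eq_comm, add_comm]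

theorem dSymm_zero_zero (σ : Fin m) (f : smoothFn (jetDomain T 3)) :
    dSymm 0 0 σ f = dVert 2 0 σ f := one_smul ℝ _

theorem dSymm_zero_one (σ : Fin m) (f : smoothFn (jetDomain T 3)) :
    dSymm 0 1 σ f = (1 / 2 : ℝ) • dVert 2 1 σ f := rfl

theorem dSymm_one_zero (σ : Fin m) (f : smoothFn (jetDomain T 3)) :
    dSymm 1 0 σ f = (1 / 2 : ℝ) • dVert 2 1 σ f := rfl

theorem dSymm_one_one (σ : Fin m) (f : smoothFn (jetDomain T 3)) :
    dSymm 1 1 σ f = dVert 2 2 σ f := one_smul ℝ _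

/-- The momenta `∂L/∂y^σ_j - d_i ∂L/∂y^σ_{ij}` of a Lagrange function. -/
def momentum (F : smoothFn (jetDomain T 3)) (j : Fin 2) (σ : Fin m) : smoothFn (jetDomain T 3) :=
  dVert 1 j σ F - ∑ i, dCut i (dSymm i j σ F)

theorem momentum_zero (F : smoothFn (jetDomain T 3)) (σ : Fin m) : momentum F 0 σ =
    dVert 1 0 σ F - dCut 0 (dVert 2 0 σ F) - (1 / 2 : ℝ) • dCut 1 (dVert 2 1 σ F) := by
  rw [momentum, Fin.sum_univ_two, dSymm_zero_zero, dSymm_one_zero, map_smul, sub_sub]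
  rfl

theorem momentum_one (F : smoothFn (jetDomain T 3)) (σ : Fin m) : momentum F 1 σ =
    dVert 1 1 σ F - (1 / 2 : ℝ) • dCut 0 (dVert 2 1 σ F) - dCut 1 (dVert 2 2 σ F) := by
  rw [momentum, Fin.sum_univ_two, dSymm_zero_one, dSymm_one_one, map_smul, sub_sub]
  rfl

/-- The relations for the pullback `F` to the third jet prolongation of a Lagrange function of
second order that satisfies the order-reducibility condition. -/
structure OrderRelations (F : smoothFn (jetDomain T 3)) : Prop where
  three : ∀ l σ, dVert 3 l σ F = 0
  cyclic : ∀ p q i j σ ν, dSymm p q ν (dSymm i j σ F) + dSymm i p ν (dSymm q j σ F) +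
    dSymm q i ν (dSymm p j σ F) = 0

namespace OrderRelations

theorem vert_two_zero_zero (h : OrderRelations F) (σ ν : Fin m) :
    dVert 2 0 σ (dVert 2 0 ν F) = 0 := by
  have hcyc := h.cyclic 0 0 0 0 ν σ
  simp only [dSymm_zero_zero] at hcyc
  linear_combination (norm := module) (1 / 3 : ℝ) • hcyc

theorem vert_two_zero_one (h : OrderRelations F) (σ ν : Fin m) :
    dVert 2 0 σ (dVert 2 1 ν F) = 0 := by
  have hcyc := h.cyclic 0 0 0 1 ν σ
  simp only [dSymm_zero_zero, dSymm_zero_one, map_smul] at hcyc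
  linear_combination (norm := module) (2 / 3 : ℝ) • hcyc

theorem vert_two_two_one (h : OrderRelations F) (σ ν : Fin m) :
    dVert 2 2 σ (dVert 2 1 ν F) = 0 := by
  have hcyc := h.cyclic 1 1 1 0 ν σ
  simp only [dSymm_one_one, dSymm_one_zero, map_smul] at hcyc
  linear_combination (norm := module) (2 / 3 : ℝ) • hcyc

theorem vert_two_two_two (h : OrderRelations F) (σ ν : Fin m) :
    dVert 2 2 σ (dVert 2 2 ν F) = 0 := by
  have hcyc := h.cyclic 1 1 1 1 ν σ
  simp only [dSymm_one_one] at hcyc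
  linear_combination (norm := module) (1 / 3 : ℝ) • hcyc

theorem vert_two_zero_two (h : OrderRelations F) (σ ν : Fin m) :
    dVert 2 0 σ (dVert 2 2 ν F) = -((1 / 2 : ℝ) • dVert 2 1 σ (dVert 2 1 ν F)) := by
  have hcyc := h.cyclic 0 0 1 1 ν σ
  simp only [dSymm_zero_zero, dSymm_one_one, dSymm_one_zero, dSymm_zero_one, map_smul] at hcyc
  linear_combination (norm := module) hcyc

theorem vert_two_one_zero (h : OrderRelations F) (σ ν : Fin m) :
    dVert 2 1 σ (dVert 2 0 ν F) = 0 := by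
  rw [dVert_comm, h.vert_two_zero_one]

theorem vert_two_one_two (h : OrderRelations F) (σ ν : Fin m) :
    dVert 2 1 σ (dVert 2 2 ν F) = 0 := by
  rw [dVert_comm, h.vert_two_two_one]

theorem vert_two_two_zero (h : OrderRelations F) (σ ν : Fin m) :
    dVert 2 2 σ (dVert 2 0 ν F) = -((1 / 2 : ℝ) • dVert 2 1 σ (dVert 2 1 ν F)) := by
  rw [dVert_comm, h.vert_two_zero_two, dVert_comm]

theorem vert_three_vert (h : OrderRelations F) (l k' l' : ℕ) (σ ν : Fin m) :
    dVert 3 l σ (dVert k' l' ν F) = 0 := by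
  rw [dVert_comm, h.three, map_zero]

theorem vert_three_dSymm (h : OrderRelations F) (l : ℕ) (i j : Fin 2) (σ ν : Fin m) :
    dVert 3 l ν (dSymm i j σ F) = 0 := by
  rw [dSymm, LinearMap.smul_apply, map_smul, h.vert_three_vert, smul_zero]

theorem vert_two_hessian (h : OrderRelations F) (l : ℕ) (ρ σ ν : Fin m) :
    dVert 2 l ρ (dVert 2 1 σ (dVert 2 1 ν F)) = 0 := by
  match l with
  | 0 => rw [dVert_comm, h.vert_two_zero_one, map_zero]
  | 1 =>
    have hhess : dVert 2 1 σ (dVert 2 1 ν F) = (-2 : ℝ) • dVert 2 0 σ (dVert 2 2 ν F) := by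
      rw [h.vert_two_zero_two]
      module
    rw [hhess, map_smul, dVert_comm, h.vert_two_one_two, map_zero, smul_zero]
  | 2 => rw [dVert_comm, h.vert_two_two_one, map_zero]
  | n + 3 => exact dVert_eq_zero (by omega) _ _

theorem vert_three_zero_momentum (h : OrderRelations F) (j : Fin 2) (ν σ : Fin m) :
    dVert 3 0 ν (momentum F j σ) = -dVert 2 0 ν (dSymm 0 j σ F) := by
  simp [momentum, Fin.sum_univ_two, dVert_dCut_zero (k := 2) (by omega), dVert_zero_dCut_one,
    h.vert_three_vert, h.vert_three_dSymm]

theorem vert_three_succ_momentum (h : OrderRelations F) (j : Fin 2) (l : ℕ) (ν σ : Fin m) :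
    dVert 3 (l + 1) ν (momentum F j σ) =
      -(dVert 2 (l + 1) ν (dSymm 0 j σ F) + dVert 2 l ν (dSymm 1 j σ F)) := by
  simp [momentum, Fin.sum_univ_two, dVert_dCut_zero (k := 2) (by omega),
    dVert_dCut_one (k := 2) (by omega), h.vert_three_vert, h.vert_three_dSymm, add_comm]

theorem vert_three_momentum (h : OrderRelations F) (l : ℕ) (ν σ : Fin m) (j : Fin 2) :
    dVert 3 l ν (momentum F j σ) = 0 := by
  revert j
  match l with
  | 0 =>
    simp [Fin.forall_fin_two, h.vert_three_zero_momentum, dSymm_zero_zero, dSymm_zero_one,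
      h.vert_two_zero_zero, h.vert_two_zero_one]
  | 1 =>
    simp [Fin.forall_fin_two, h.vert_three_succ_momentum, dSymm_zero_zero, dSymm_zero_one,
      dSymm_one_zero, dSymm_one_one, h.vert_two_one_zero, h.vert_two_zero_one,
      h.vert_two_zero_two]
  | 2 =>
    simp [Fin.forall_fin_two, h.vert_three_succ_momentum, dSymm_zero_zero, dSymm_zero_one,
      dSymm_one_zero, dSymm_one_one, h.vert_two_two_zero, h.vert_two_two_one,
      h.vert_two_one_two]
  | 3 =>
    simp [Fin.forall_fin_two, h.vert_three_succ_momentum, dVert_eq_zero (show 2 < 3 by omega),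
      dSymm_one_zero, dSymm_one_one, h.vert_two_two_one, h.vert_two_two_two]
  | n + 4 => exact fun _ => dVert_eq_zero (by omega) _ _

theorem vert_two_zero_momentum_one (h : OrderRelations F) (σ ν : Fin m) :
    dVert 2 0 σ (momentum F 1 ν) =
      dVert 1 1 ν (dVert 2 0 σ F) - (1 / 2 : ℝ) • dVert 1 0 σ (dVert 2 1 ν F)
        + (1 / 2 : ℝ) • dCut 1 (dVert 2 1 σ (dVert 2 1 ν F)) := by
  rw [momentum_one, map_sub, map_sub, map_smul, dVert_dCut_zero (by omega), dVert_zero_dCut_one,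
    h.vert_two_zero_one, h.vert_two_zero_two, map_neg, map_smul, map_zero, dVert_comm 2 0 1 1]
  module

theorem vert_two_one_momentum_one (h : OrderRelations F) (σ ν : Fin m) :
    dVert 2 1 σ (momentum F 1 ν) =
      dVert 1 1 ν (dVert 2 1 σ F) - (1 / 2 : ℝ) • dCut 0 (dVert 2 1 σ (dVert 2 1 ν F))
        - (1 / 2 : ℝ) • dVert 1 1 σ (dVert 2 1 ν F) - dVert 1 0 σ (dVert 2 2 ν F) := by
  rw [momentum_one, map_sub, map_sub, map_smul, dVert_dCut_zero (by omega),
    dVert_dCut_one (by omega), h.vert_two_one_two, map_zero, dVert_comm 2 1 1 1]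
  module

theorem vert_two_one_momentum_zero (h : OrderRelations F) (σ ν : Fin m) :
    dVert 2 1 σ (momentum F 0 ν) =
      dVert 1 0 ν (dVert 2 1 σ F) - dVert 1 1 σ (dVert 2 0 ν F)
        - (1 / 2 : ℝ) • dCut 1 (dVert 2 1 σ (dVert 2 1 ν F))
        - (1 / 2 : ℝ) • dVert 1 0 σ (dVert 2 1 ν F) := by
  rw [momentum_zero, map_sub, map_sub, map_smul, dVert_dCut_zero (by omega),
    dVert_dCut_one (by omega), h.vert_two_one_zero, map_zero, dVert_comm 2 1 1 0]
  module

theorem vert_two_two_momentum_zero (h : OrderRelations F) (σ ν : Fin m) :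
    dVert 2 2 σ (momentum F 0 ν) =
      dVert 1 0 ν (dVert 2 2 σ F) + (1 / 2 : ℝ) • dCut 0 (dVert 2 1 σ (dVert 2 1 ν F))
        - (1 / 2 : ℝ) • dVert 1 1 σ (dVert 2 1 ν F) := by
  rw [momentum_zero, map_sub, map_sub, map_smul, dVert_dCut_zero (by omega),
    dVert_dCut_one (by omega), h.vert_two_two_zero, h.vert_two_two_one, map_neg, map_smul, map_zero,
    dVert_comm 2 2 1 0, dVert_eq_zero (k := 1) (l := 2) (by omega)]
  module

end OrderRelations

/-- The relations for the pullback `F` to the third jet prolongation of a variationally trivial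
Lagrange function of second order that satisfies the order-reducibility condition. -/
structure TrivialRelations (F : smoothFn (jetDomain T 3)) : Prop extends OrderRelations F where
  euler : ∀ σ, dVert 0 0 σ F = ∑ i, dCut i (momentum F i σ)

namespace TrivialRelations

theorem vert_two_momentum (h : TrivialRelations F) (l : ℕ) (ν σ : Fin m) :
    dVert 2 (l + 1) ν (momentum F 0 σ) + dVert 2 l ν (momentum F 1 σ) = 0 := by
  have hthree := congrArg (dVert 3 (l + 1) ν) (h.euler σ)
  rw [Fin.sum_univ_two, h.vert_three_vert, map_add, dVert_dCut_zero (by omega),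
    dVert_dCut_one (by omega), h.vert_three_momentum, h.vert_three_momentum] at hthree
  simpa using hthree.symm

theorem exchange_zero (h : TrivialRelations F) (σ ν : Fin m) :
    dVert 1 0 σ (dVert 2 1 ν F) - dVert 1 0 ν (dVert 2 1 σ F)
      + dVert 1 1 σ (dVert 2 0 ν F) - dVert 1 1 ν (dVert 2 0 σ F) = 0 := by
  have hmom := h.vert_two_momentum 0 ν σ
  rw [h.vert_two_one_momentum_zero, h.vert_two_zero_momentum_one] at hmom
  linear_combination (norm := module) hmom

theorem exchange_one (h : TrivialRelations F) (σ ν : Fin m) :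
    dVert 1 1 σ (dVert 2 1 ν F) - dVert 1 1 ν (dVert 2 1 σ F)
      + dVert 1 0 σ (dVert 2 2 ν F) - dVert 1 0 ν (dVert 2 2 σ F) = 0 := by
  have hmom := h.vert_two_momentum 1 ν σ
  rw [h.vert_two_two_momentum_zero, h.vert_two_one_momentum_one] at hmom
  linear_combination (norm := module) hmom

theorem vert_two_skew (h : TrivialRelations F) (l : ℕ) (ρ σ ν : Fin m) (j : Fin 2) :
    dVert 2 l ρ (dVert 1 j σ (dVert 2 1 ν F) - dVert 1 j ν (dVert 2 1 σ F)) = 0 := by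
  revert j
  match l with
  | 0 => simp [dVert_comm 2 0, h.vert_two_one_zero]
  | 1 =>
    have hzero := congrArg (dVert 2 1 ρ) (h.exchange_zero σ ν)
    have hone := congrArg (dVert 2 1 ρ) (h.exchange_one σ ν)
    rw [map_sub, map_add, dVert_comm 2 1 1 1, dVert_comm 2 1 1 1, h.vert_two_one_zero,
      h.vert_two_one_zero, map_zero, map_zero, add_zero, sub_zero] at hzero
    rw [map_sub, map_add, dVert_comm 2 1 1 0, dVert_comm 2 1 1 0, h.vert_two_one_two,
      h.vert_two_one_two, map_zero, map_zero, add_zero, sub_zero] at hone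
    exact Fin.forall_fin_two.2 ⟨hzero.trans (map_zero _), hone.trans (map_zero _)⟩
  | 2 => simp [dVert_comm 2 2, h.vert_two_one_two]
  | n + 3 => exact fun _ => dVert_eq_zero (by omega) _ _

end TrivialRelations

/-- The coefficients `P_{σν}` of the fundamental form, with `d_i` in place of `d'_i`; see
`IsPullback.lepageP` for the comparison. -/
def lepageP (F : smoothFn (jetDomain T 3)) (σ ν : Fin m) : smoothFn (jetDomain T 3) :=
  (1 / 2 : ℝ) • (dVert 1 0 σ (dVert 1 1 ν F) - dVert 1 0 ν (dVert 1 1 σ F))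
    + dCut 0 (dVert 1 0 ν (dSymm 0 1 σ F) - dVert 1 0 σ (dSymm 0 1 ν F))
    + dCut 1 (dVert 1 1 σ (dSymm 0 1 ν F) - dVert 1 1 ν (dSymm 0 1 σ F))

/-- The coefficients `Q^j_{σ,ν}` of the fundamental form, with `d_i` in place of `d'_i`. -/
def lepageQ (F : smoothFn (jetDomain T 3)) (j : Fin 2) (σ ν : Fin m) : smoothFn (jetDomain T 3) :=
  if j = 0 then
    (2 : ℝ) • dVert 1 0 σ (dSymm 0 1 ν F) - dVert 1 0 ν (dSymm 0 1 σ F)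
      - dVert 1 1 ν (dSymm 0 0 σ F) - (2 : ℝ) • dCut 1 (dSymm 0 1 σ (dSymm 0 1 ν F))
  else
    (-2 : ℝ) • dVert 1 1 σ (dSymm 0 1 ν F) + dVert 1 0 ν (dSymm 1 1 σ F)
      + dVert 1 1 ν (dSymm 0 1 σ F) + (2 : ℝ) • dCut 0 (dSymm 0 1 σ (dSymm 0 1 ν F))

/-- The coefficients `R^{i,j}_{σ,ν}` of the fundamental form. -/
def lepageR (F : smoothFn (jetDomain T 3)) (i j : Fin 2) (σ ν : Fin m) :
    smoothFn (jetDomain T 3) :=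
  if i = j then 0
  else if i = 0 then (-2 : ℝ) • dSymm 0 1 σ (dSymm 0 1 ν F)
  else (2 : ℝ) • dSymm 0 1 σ (dSymm 0 1 ν F)

theorem lepageQ_zero (F : smoothFn (jetDomain T 3)) (σ ν : Fin m) : lepageQ F 0 σ ν =
    dVert 1 0 σ (dVert 2 1 ν F) - (1 / 2 : ℝ) • dVert 1 0 ν (dVert 2 1 σ F)
      - dVert 1 1 ν (dVert 2 0 σ F) - (1 / 2 : ℝ) • dCut 1 (dVert 2 1 σ (dVert 2 1 ν F)) := by
  rw [lepageQ, if_pos rfl]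
  simp only [dSymm_zero_one, dSymm_zero_zero, map_smul]
  module

theorem lepageQ_one (F : smoothFn (jetDomain T 3)) (σ ν : Fin m) : lepageQ F 1 σ ν =
    -dVert 1 1 σ (dVert 2 1 ν F) + dVert 1 0 ν (dVert 2 2 σ F)
      + (1 / 2 : ℝ) • dVert 1 1 ν (dVert 2 1 σ F)
      + (1 / 2 : ℝ) • dCut 0 (dVert 2 1 σ (dVert 2 1 ν F)) := by
  rw [lepageQ, if_neg one_ne_zero]
  simp only [dSymm_zero_one, dSymm_one_one, map_smul]
  module

theorem lepageR_self (F : smoothFn (jetDomain T 3)) (i : Fin 2) (σ ν : Fin m) :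
    lepageR F i i σ ν = 0 := if_pos rfl

theorem lepageR_zero_one (F : smoothFn (jetDomain T 3)) (σ ν : Fin m) :
    lepageR F 0 1 σ ν = -(1 / 2 : ℝ) • dVert 2 1 σ (dVert 2 1 ν F) := by
  rw [lepageR, if_neg zero_ne_one, if_pos rfl, dSymm_zero_one, dSymm_zero_one, map_smul]
  module

theorem lepageR_one_zero (F : smoothFn (jetDomain T 3)) (σ ν : Fin m) :
    lepageR F 1 0 σ ν = (1 / 2 : ℝ) • dVert 2 1 σ (dVert 2 1 ν F) := by
  rw [lepageR, if_neg one_ne_zero, if_neg one_ne_zero, dSymm_zero_one, dSymm_zero_one, map_smul]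
  module

namespace TrivialRelations

theorem vert_two_zero_momentum_add_lepageQ (h : TrivialRelations F) (σ ν : Fin m) :
    dVert 2 0 σ (momentum F 1 ν) + lepageQ F 0 ν σ = 0 := by
  rw [h.vert_two_zero_momentum_one, lepageQ_zero, dVert_comm 2 1 2 1 ν σ]
  linear_combination (norm := module) h.exchange_zero ν σ

theorem vert_two_one_momentum_add_lepageQ (h : TrivialRelations F) (σ ν : Fin m) :
    dVert 2 1 σ (momentum F 1 ν) + lepageQ F 1 ν σ = 0 := by
  rw [h.vert_two_one_momentum_one, lepageQ_one, dVert_comm 2 1 2 1 ν σ]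
  module

theorem lepageQ_zero_skew (h : TrivialRelations F) (σ ν : Fin m) :
    lepageQ F 0 σ ν - lepageQ F 0 ν σ = (1 / 2 : ℝ) • dVert 1 0 σ (dVert 2 1 ν F)
      - (1 / 2 : ℝ) • dVert 1 0 ν (dVert 2 1 σ F) := by
  rw [lepageQ_zero, lepageQ_zero, dVert_comm 2 1 2 1 ν σ]
  linear_combination (norm := module) h.exchange_zero σ ν

theorem lepageP_eq (h : TrivialRelations F) (σ ν : Fin m) :
    lepageP F σ ν - dCut 0 (lepageQ F 0 ν σ) - dVert 1 0 σ (momentum F 1 ν)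
      + (1 / 2 : ℝ) • dVert 0 0 ν (dVert 2 1 σ F) =
    lepageP F ν σ - dCut 0 (lepageQ F 0 σ ν) - dVert 1 0 ν (momentum F 1 σ)
      + (1 / 2 : ℝ) • dVert 0 0 σ (dVert 2 1 ν F) := by
  have hzero := congrArg (dCut 0) (h.exchange_zero σ ν)
  have hone := congrArg (dCut 1) (h.exchange_one σ ν)
  simp only [map_sub, map_add, map_zero] at hzero hone
  simp only [lepageP, lepageQ_zero, momentum_one, dSymm_zero_one, map_sub, map_smul,
    dVert_dCut_zero (k := 0) (by omega), dVert_zero_dCut_one, dVert_comm 2 1 2 1 ν σ]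
  linear_combination (norm := module) hzero + hone

end TrivialRelations

end Identities

section ClosedForms

open TopologicalSpace (Opens)

variable {m r n : ℕ} {W : Type*} [NormedAddCommGroup W] [NormedSpace ℝ W]
  {T : Opens ((Fin 2 → ℝ) × (Fin m → ℝ))}

theorem curryLeft_eq_zero_of_frame {z u : JetCoords m r} {α : JetCoords m r [⋀^Fin 2]→L[ℝ] W}
    (hcut : ∀ i, α ![u, cutVec i z] = 0) (hvert : ∀ k l σ, α ![u, coordVec k l σ] = 0) :
    α.curryLeft u = 0 := by
  have hcurry {w : JetCoords m r} (h : α ![u, w] = 0) : (α.curryLeft u).curryLeft w = 0 :=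
    ContinuousAlternatingMap.ext fun v => by
      rw [Subsingleton.elim v ![]]
      exact h
  exact form_eq_zero_of_frame (fun i => hcurry (hcut i)) fun k l σ => hcurry (hvert k l σ)

theorem form_two_eq_zero_of_frame {z : JetCoords m r} {α : JetCoords m r [⋀^Fin 2]→L[ℝ] W}
    (hcut : α ![cutVec 0 z, cutVec 1 z] = 0)
    (hmixed : ∀ i k l σ, α ![cutVec i z, coordVec k l σ] = 0)
    (hvert : ∀ k l σ k' l' ν, α ![coordVec k l σ, coordVec k' l' ν] = 0) : α = 0 := by
  have hcut' (i j : Fin 2) : α ![cutVec i z, cutVec j z] = 0 := by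
    have hself (w : JetCoords m r) : α ![w, w] = 0 :=
      α.map_eq_zero_of_eq _ (i := 0) (j := 1) rfl zero_ne_one
    revert i j
    simp only [Fin.forall_fin_two, hself, hcut, form_swap α (cutVec 1 z) (cutVec 0 z), neg_zero,
      and_self]
  refine form_eq_zero_of_frame (fun i => curryLeft_eq_zero_of_frame (hcut' i) (hmixed i))
    fun k l σ => curryLeft_eq_zero_of_frame (z := z) (fun i => ?_) (hvert k l σ)
  rw [form_swap, hmixed, neg_zero]

theorem coordVec_cases {p : JetCoords m 3 → Prop} (σ : Fin m) (h00 : p (coordVec 0 0 σ))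
    (h10 : p (coordVec 1 0 σ)) (h11 : p (coordVec 1 1 σ)) (h20 : p (coordVec 2 0 σ))
    (h21 : p (coordVec 2 1 σ)) (h22 : p (coordVec 2 2 σ)) (h3 : ∀ l, p (coordVec 3 l σ))
    (k l : ℕ) : p (coordVec k l σ) := by
  have h0 : p 0 := coordVec_eq_zero (r := 3) (k := 3) (l := 4) (by omega) σ ▸ h3 4
  match k, l with
  | 0, 0 => exact h00
  | 1, 0 => exact h10
  | 1, 1 => exact h11
  | 2, 0 => exact h20
  | 2, 1 => exact h21
  | 2, 2 => exact h22
  | 3, l => exact h3 l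
  | 0, l + 1 => rwa [coordVec_eq_zero (by omega)]
  | 1, l + 2 => rwa [coordVec_eq_zero (by omega)]
  | 2, l + 3 => rwa [coordVec_eq_zero (by omega)]
  | k + 4, l => rwa [coordVec_eq_zero (by omega)]

theorem shift_zero_coordVec {k : ℕ} (hk : k < r) (l : ℕ) (σ : Fin m) :
    shift 0 (coordVec (k + 1) l σ : JetCoords m r) = coordVec k l σ :=
  shift_coordVec 0 hk σ

theorem shift_one_coordVec {k : ℕ} (hk : k < r) (l : ℕ) (σ : Fin m) :
    shift 1 (coordVec (k + 1) (l + 1) σ : JetCoords m r) = coordVec k l σ :=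
  shift_coordVec 1 hk σ

theorem shift_one_coordVec_zero (k : ℕ) (σ : Fin m) :
    shift 1 (coordVec k 0 σ : JetCoords m r) = 0 :=
  shift_coordVec_of_lt 1 (Or.inr zero_lt_one) σ

theorem shift_coordVec_zero (i : Fin 2) (l : ℕ) (σ : Fin m) :
    shift i (coordVec 0 l σ : JetCoords m r) = 0 :=
  shift_coordVec_of_lt i (Or.inl rfl) σ

theorem shift_coordVec_succ (i : Fin 2) {k : ℕ} (hk : k < r) (l : ℕ) (σ : Fin m) :
    ∃ l', shift i (coordVec (k + 1) l σ : JetCoords m r) = coordVec k l' σ := by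
  match i, l with
  | 0, l => exact ⟨l, shift_zero_coordVec hk l σ⟩
  | 1, 0 => exact ⟨k + 1, by rw [shift_one_coordVec_zero, coordVec_eq_zero (by omega)]⟩
  | 1, l + 1 => exact ⟨l, shift_one_coordVec hk l σ⟩

/-- The contraction of a form with the cut formal derivative field `d'_i`. -/
def contr (ρ : JetCoords m r → JetCoords m r [⋀^Fin (n + 1)]→L[ℝ] W) (i : Fin 2)
    (z : JetCoords m r) : JetCoords m r [⋀^Fin n]→L[ℝ] W :=
  (ρ z).curryLeft (cutVec i z)

/-- A closed 3-form on the third jet prolongation which is annihilated by `d'_1 ∧ d'_2`, like the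
exterior derivative of a Lepage form, and which has no components in `dy^σ_J` with `|J| = 3`. -/
structure IsClosedContact (T : Opens ((Fin 2 → ℝ) × (Fin m → ℝ)))
    (ρ : JetCoords m 3 → JetCoords m 3 [⋀^Fin 3]→L[ℝ] W) : Prop where
  differentiableAt : ∀ z ∈ jetDomain T 3, DifferentiableAt ℝ ρ z
  closed : ∀ z ∈ jetDomain T 3, extDeriv ρ z = 0
  contact : ∀ z ∈ jetDomain T 3, (contr ρ 0 z).curryLeft (cutVec 1 z) = 0
  order : ∀ z ∈ jetDomain T 3, ∀ l σ, (ρ z).curryLeft (coordVec 3 l σ) = 0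

namespace IsClosedContact

variable {ρ : JetCoords m 3 → JetCoords m 3 [⋀^Fin 3]→L[ℝ] W} {z : JetCoords m 3}

theorem contr_three (h : IsClosedContact T ρ) (hz : z ∈ jetDomain T 3) (i : Fin 2) (l : ℕ)
    (σ : Fin m) : (contr ρ i z).curryLeft (coordVec 3 l σ) = 0 :=
  ContinuousAlternatingMap.ext fun v =>
    form_eq_zero_of_curryLeft_eq_zero
      (v := Matrix.vecCons (cutVec i z) (Matrix.vecCons (coordVec 3 l σ) v)) 1 (h.order z hz l σ)

theorem contr_exchange (h : IsClosedContact T ρ) {u v : JetCoords m 3}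
    (h₀ : ∀ z ∈ jetDomain T 3, contr ρ 0 z ![u, v] = 0)
    (h₁ : ∀ z ∈ jetDomain T 3, contr ρ 1 z ![u, v] = 0) (hz : z ∈ jetDomain T 3) :
    contr ρ 1 z ![shift 0 u, v] + contr ρ 1 z ![u, shift 0 v] =
      contr ρ 0 z ![shift 1 u, v] + contr ρ 0 z ![u, shift 1 v] := by
  have hnhds := (jetDomain T 3).isOpen.mem_nhds hz
  have hexch := form_three_fderiv_exchange (h.differentiableAt z hz) (h.closed z hz)
    (hasFDerivAt_cutVec 0 z).differentiableAt (hasFDerivAt_cutVec 1 z).differentiableAt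
    (lieBracket_cutVec_cutVec 0 1 z)
    (Filter.eventually_of_mem hnhds fun w hw a => DFunLike.congr_fun (h.contact w hw) ![a])
    (Filter.eventually_of_mem hnhds h₀) (Filter.eventually_of_mem hnhds h₁)
  rwa [(hasFDerivAt_cutVec 0 z).fderiv, (hasFDerivAt_cutVec 1 z).fderiv] at hexch

theorem contr_shift (h : IsClosedContact T ρ) {u : JetCoords m 3}
    (hu : ∀ i, ∀ z ∈ jetDomain T 3, (contr ρ i z).curryLeft u = 0) (hz : z ∈ jetDomain T 3) :
    (contr ρ 1 z).curryLeft (shift 0 u) = (contr ρ 0 z).curryLeft (shift 1 u) := by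
  have hval (i : Fin 2) (v : JetCoords m 3) :
      ∀ z ∈ jetDomain T 3, contr ρ i z ![u, v] = 0 :=
    fun z hz => DFunLike.congr_fun (hu i z hz) ![v]
  refine ContinuousAlternatingMap.ext fun v => ?_
  have hexch := h.contr_exchange (hval 0 (v 0)) (hval 1 (v 0)) hz
  rw [hval 1 _ z hz, hval 0 _ z hz, add_zero, add_zero] at hexch
  rwa [← List.ofFn_inj.1 (by simp : List.ofFn ![v 0] = List.ofFn v)]

theorem contr_zero_two (h : IsClosedContact T ρ)
    (h20 : ∀ z ∈ jetDomain T 3, ∀ σ, (contr ρ 0 z).curryLeft (coordVec 2 0 σ) = 0)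
    (h21 : ∀ z ∈ jetDomain T 3, ∀ σ, (contr ρ 0 z).curryLeft (coordVec 2 1 σ) = 0)
    (l : ℕ) (σ : Fin m) (hz : z ∈ jetDomain T 3) :
    (contr ρ 0 z).curryLeft (coordVec 2 l σ) = 0 := by
  match l with
  | 0 => exact h20 z hz σ
  | 1 => exact h21 z hz σ
  | 2 =>
    have hshift := h.contr_shift (fun i z hz => h.contr_three hz i 3 σ) hz
    rwa [shift_zero_coordVec (by omega), shift_one_coordVec (by omega),
      coordVec_eq_zero (by omega), map_zero, eq_comm] at hshift
  | l + 3 => rw [coordVec_eq_zero (by omega), map_zero]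

theorem contr_two (h : IsClosedContact T ρ)
    (h20 : ∀ z ∈ jetDomain T 3, ∀ σ, (contr ρ 0 z).curryLeft (coordVec 2 0 σ) = 0)
    (h21 : ∀ z ∈ jetDomain T 3, ∀ σ, (contr ρ 0 z).curryLeft (coordVec 2 1 σ) = 0)
    (l : ℕ) (σ : Fin m) (i : Fin 2) (hz : z ∈ jetDomain T 3) :
    (contr ρ i z).curryLeft (coordVec 2 l σ) = 0 := by
  match i with
  | 0 => exact h.contr_zero_two h20 h21 l σ hz
  | 1 =>
    have hshift := h.contr_shift (fun i z hz => h.contr_three hz i l σ) hz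
    obtain ⟨l', hl'⟩ := shift_coordVec_succ (r := 3) 1 (k := 2) (by omega) l σ
    rwa [shift_zero_coordVec (by omega), hl', h.contr_zero_two h20 h21 l' σ hz] at hshift

theorem contr_zero_one_one (h : IsClosedContact T ρ)
    (h2 : ∀ i, ∀ z ∈ jetDomain T 3, ∀ l σ, (contr ρ i z).curryLeft (coordVec 2 l σ) = 0)
    (σ : Fin m) (hz : z ∈ jetDomain T 3) : (contr ρ 0 z).curryLeft (coordVec 1 1 σ) = 0 := by
  have hshift := h.contr_shift (fun i z hz => h2 i z hz 2 σ) hz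
  rwa [shift_zero_coordVec (by omega), shift_one_coordVec (by omega),
    coordVec_eq_zero (by omega), map_zero, eq_comm] at hshift

theorem contr_one_one_one (h : IsClosedContact T ρ)
    (h2 : ∀ i, ∀ z ∈ jetDomain T 3, ∀ l σ, (contr ρ i z).curryLeft (coordVec 2 l σ) = 0)
    (σ : Fin m) (hz : z ∈ jetDomain T 3) :
    (contr ρ 1 z).curryLeft (coordVec 1 1 σ) = (contr ρ 0 z).curryLeft (coordVec 1 0 σ) := by
  have hshift := h.contr_shift (fun i z hz => h2 i z hz 1 σ) hz
  rwa [shift_zero_coordVec (by omega), shift_one_coordVec (by omega)] at hshift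

theorem contr_zero_one_zero_zero_zero (h : IsClosedContact T ρ)
    (h2 : ∀ i, ∀ z ∈ jetDomain T 3, ∀ l σ, (contr ρ i z).curryLeft (coordVec 2 l σ) = 0)
    (h10 : ∀ z ∈ jetDomain T 3, ∀ σ ν, contr ρ 0 z ![coordVec 1 0 σ, coordVec 1 0 ν] = 0)
    (hsymm : ∀ z ∈ jetDomain T 3, ∀ σ ν, contr ρ 0 z ![coordVec 1 0 σ, coordVec 0 0 ν] =
      contr ρ 0 z ![coordVec 1 0 ν, coordVec 0 0 σ])
    (σ ν : Fin m) (hz : z ∈ jetDomain T 3) :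
    contr ρ 0 z ![coordVec 1 0 σ, coordVec 0 0 ν] = 0 := by
  have hone (v : JetCoords m 3) : ∀ z ∈ jetDomain T 3,
      contr ρ 1 z ![coordVec 1 1 σ, v] = contr ρ 0 z ![coordVec 1 0 σ, v] :=
    fun z hz => DFunLike.congr_fun (h.contr_one_one_one h2 σ hz) ![v]
  have hexch := h.contr_exchange (u := coordVec 1 1 σ) (v := coordVec 1 0 ν)
    (fun z hz => DFunLike.congr_fun (h.contr_zero_one_one h2 σ hz) ![coordVec 1 0 ν])
    (fun z hz => (hone _ z hz).trans (h10 z hz σ ν)) hz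
  have hleft (i : Fin 2) (v : JetCoords m 3) : contr ρ i z ![0, v] = 0 :=
    (contr ρ i z).map_coord_zero 0 rfl
  have hright (i : Fin 2) (v : JetCoords m 3) : contr ρ i z ![v, 0] = 0 :=
    (contr ρ i z).map_coord_zero 1 rfl
  rw [shift_zero_coordVec (by omega), coordVec_eq_zero (k := 0) (by omega), hleft, zero_add,
    shift_zero_coordVec (by omega), hone _ z hz, shift_one_coordVec (by omega),
    shift_one_coordVec_zero, hright, add_zero, form_swap (contr ρ 0 z) (coordVec 0 0 σ),
    hsymm z hz ν σ] at hexch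
  linear_combination (norm := module) (1 / 2 : ℝ) • hexch

theorem contr_zero_one_zero (h : IsClosedContact T ρ)
    (h2 : ∀ i, ∀ z ∈ jetDomain T 3, ∀ l σ, (contr ρ i z).curryLeft (coordVec 2 l σ) = 0)
    (h10 : ∀ z ∈ jetDomain T 3, ∀ σ ν, contr ρ 0 z ![coordVec 1 0 σ, coordVec 1 0 ν] = 0)
    (hsymm : ∀ z ∈ jetDomain T 3, ∀ σ ν, contr ρ 0 z ![coordVec 1 0 σ, coordVec 0 0 ν] =
      contr ρ 0 z ![coordVec 1 0 ν, coordVec 0 0 σ])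
    (σ : Fin m) (hz : z ∈ jetDomain T 3) : (contr ρ 0 z).curryLeft (coordVec 1 0 σ) = 0 := by
  have hof {w : JetCoords m 3} (hw : (contr ρ 0 z).curryLeft w = 0) :
      contr ρ 0 z ![coordVec 1 0 σ, w] = 0 :=
    form_eq_zero_of_curryLeft_eq_zero (v := ![coordVec 1 0 σ, w]) 1 hw
  refine curryLeft_eq_zero_of_frame
    (Fin.forall_fin_two.2 ⟨hof ((ρ z).curryLeft_same _), hof (h.contact z hz)⟩) fun k l ν => ?_
  exact coordVec_cases (p := fun w => contr ρ 0 z ![coordVec 1 0 σ, w] = 0) ν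
    (h.contr_zero_one_zero_zero_zero h2 h10 hsymm σ ν hz) (h10 z hz σ ν)
    (hof (h.contr_zero_one_one h2 ν hz)) (hof (h2 0 z hz 0 ν)) (hof (h2 0 z hz 1 ν))
    (hof (h2 0 z hz 2 ν)) (fun l => hof (h.contr_three hz 0 l ν)) k l

theorem contr_zero_zero (h : IsClosedContact T ρ)
    (h11 : ∀ i, ∀ z ∈ jetDomain T 3, ∀ σ, (contr ρ i z).curryLeft (coordVec 1 1 σ) = 0)
    (σ : Fin m) (hz : z ∈ jetDomain T 3) : (contr ρ 0 z).curryLeft (coordVec 0 0 σ) = 0 := by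
  have hshift := h.contr_shift (fun i z hz => h11 i z hz σ) hz
  rwa [shift_zero_coordVec (by omega), shift_one_coordVec (by omega),
    coordVec_eq_zero (k := 0) (l := 1) (by omega), map_zero, eq_comm] at hshift

theorem contr_zero (h : IsClosedContact T ρ)
    (h20 : ∀ z ∈ jetDomain T 3, ∀ σ, (contr ρ 0 z).curryLeft (coordVec 2 0 σ) = 0)
    (h21 : ∀ z ∈ jetDomain T 3, ∀ σ, (contr ρ 0 z).curryLeft (coordVec 2 1 σ) = 0)
    (h10 : ∀ z ∈ jetDomain T 3, ∀ σ ν, contr ρ 0 z ![coordVec 1 0 σ, coordVec 1 0 ν] = 0)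
    (hsymm : ∀ z ∈ jetDomain T 3, ∀ σ ν, contr ρ 0 z ![coordVec 1 0 σ, coordVec 0 0 ν] =
      contr ρ 0 z ![coordVec 1 0 ν, coordVec 0 0 σ])
    (hz : z ∈ jetDomain T 3) : contr ρ 0 z = 0 := by
  have h2 (i : Fin 2) (z) (hz : z ∈ jetDomain T 3) (l : ℕ) (σ : Fin m) :
      (contr ρ i z).curryLeft (coordVec 2 l σ) = 0 := h.contr_two h20 h21 l σ i hz
  have hone (z) (hz : z ∈ jetDomain T 3) (σ : Fin m) :
      (contr ρ 0 z).curryLeft (coordVec 1 0 σ) = 0 := h.contr_zero_one_zero h2 h10 hsymm σ hz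
  have h11 (i : Fin 2) (z) (hz : z ∈ jetDomain T 3) (σ : Fin m) :
      (contr ρ i z).curryLeft (coordVec 1 1 σ) = 0 := by
    match i with
    | 0 => exact h.contr_zero_one_one h2 σ hz
    | 1 => rw [h.contr_one_one_one h2 σ hz, hone z hz σ]
  refine form_eq_zero_of_frame
    (Fin.forall_fin_two.2 ⟨(ρ z).curryLeft_same _, h.contact z hz⟩) fun k l σ => ?_
  exact coordVec_cases (p := fun w => (contr ρ 0 z).curryLeft w = 0) σ
    (h.contr_zero_zero h11 σ hz) (hone z hz σ) (h11 0 z hz σ) (h2 0 z hz 0 σ) (h2 0 z hz 1 σ)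
    (h2 0 z hz 2 σ) (fun l => h.contr_three hz 0 l σ) k l

theorem eq_zero (h : IsClosedContact T ρ)
    (h20 : ∀ z ∈ jetDomain T 3, ∀ σ, (contr ρ 0 z).curryLeft (coordVec 2 0 σ) = 0)
    (h21 : ∀ z ∈ jetDomain T 3, ∀ σ, (contr ρ 0 z).curryLeft (coordVec 2 1 σ) = 0)
    (h10 : ∀ z ∈ jetDomain T 3, ∀ σ ν, contr ρ 0 z ![coordVec 1 0 σ, coordVec 1 0 ν] = 0)
    (hsymm : ∀ z ∈ jetDomain T 3, ∀ σ ν, contr ρ 0 z ![coordVec 1 0 σ, coordVec 0 0 ν] =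
      contr ρ 0 z ![coordVec 1 0 ν, coordVec 0 0 σ]) :
    ∀ z ∈ jetDomain T 3, ρ z = 0 :=
  form_eq_zero_of_extDeriv_eq_zero h.differentiableAt h.closed
    (fun _ hz => h.contr_zero h20 h21 h10 hsymm hz) h.order

end IsClosedContact

end ClosedForms

section FrameValues

open TopologicalSpace (Opens)

variable {m : ℕ} {T : Opens ((Fin 2 → ℝ) × (Fin m → ℝ))}

/-- The values of a Lepage equivalent of `F dx¹ ∧ dx²` on `d'_i` and a vertical coordinate vector:
by the Lepage property they are determined by `F`. -/
def mixedCoeff (F : smoothFn (jetDomain T 3)) (i : Fin 2) (k l : ℕ) (σ : Fin m) :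
    smoothFn (jetDomain T 3) :=
  match i, k, l with
  | 0, 0, 0 => momentum F 1 σ
  | 0, 1, 0 => (1 / 2 : ℝ) • dVert 2 1 σ F
  | 0, 1, 1 => dVert 2 2 σ F
  | 1, 0, 0 => -momentum F 0 σ
  | 1, 1, 0 => -dVert 2 0 σ F
  | 1, 1, 1 => -(1 / 2 : ℝ) • dVert 2 1 σ F
  | _, _, _ => 0

/-- The values of the 2-contact form with coefficients `P`, `Q`, `R` on two vertical coordinate
vectors. -/
def vertCoeff (P : Fin m → Fin m → smoothFn (jetDomain T 3))
    (Q : Fin 2 → Fin m → Fin m → smoothFn (jetDomain T 3))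
    (R : Fin 2 → Fin 2 → Fin m → Fin m → smoothFn (jetDomain T 3))
    (k l : ℕ) (σ : Fin m) (k' l' : ℕ) (ν : Fin m) : smoothFn (jetDomain T 3) :=
  match k, l, k', l' with
  | 0, 0, 0, 0 => P σ ν
  | 0, 0, 1, 0 => Q 0 σ ν
  | 0, 0, 1, 1 => Q 1 σ ν
  | 1, 0, 0, 0 => -Q 0 ν σ
  | 1, 1, 0, 0 => -Q 1 ν σ
  | 1, 0, 1, 0 => R 0 0 σ ν
  | 1, 0, 1, 1 => R 0 1 σ ν
  | 1, 1, 1, 0 => R 1 0 σ ν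
  | 1, 1, 1, 1 => R 1 1 σ ν
  | _, _, _, _ => 0

/-- The values of the 2-form `η` on the frame formed by the cut formal derivatives and the vertical
coordinate vectors are those of the Lepage equivalent of `F dx¹ ∧ dx²` whose 2-contact part has the
coefficients `P`, `Q`, `R`. -/
structure HasFrameValues (η : JetCoords m 3 → JetCoords m 3 [⋀^Fin 2]→L[ℝ] ℝ)
    (F : smoothFn (jetDomain T 3)) (P : Fin m → Fin m → smoothFn (jetDomain T 3))
    (Q : Fin 2 → Fin m → Fin m → smoothFn (jetDomain T 3))
    (R : Fin 2 → Fin 2 → Fin m → Fin m → smoothFn (jetDomain T 3)) : Prop where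
  smooth : ContDiffOn ℝ ∞ η (jetDomain T 3)
  base : ∀ z ∈ jetDomain T 3, η z ![cutVec 0 z, cutVec 1 z] = F.1 z
  mixed : ∀ z ∈ jetDomain T 3, ∀ i k l σ,
    η z ![cutVec i z, coordVec k l σ] = (mixedCoeff F i k l σ).1 z
  vert : ∀ z ∈ jetDomain T 3, ∀ k l σ k' l' ν,
    η z ![coordVec k l σ, coordVec k' l' ν] = (vertCoeff P Q R k l σ k' l' ν).1 z

namespace HasFrameValues

variable {η : JetCoords m 3 → JetCoords m 3 [⋀^Fin 2]→L[ℝ] ℝ} {F : smoothFn (jetDomain T 3)}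
  {P : Fin m → Fin m → smoothFn (jetDomain T 3)}
  {Q : Fin 2 → Fin m → Fin m → smoothFn (jetDomain T 3)}
  {R : Fin 2 → Fin 2 → Fin m → Fin m → smoothFn (jetDomain T 3)} {z : JetCoords m 3}

theorem contDiffAt (h : HasFrameValues η F P Q R) (hz : z ∈ jetDomain T 3) : ContDiffAt ℝ ∞ η z :=
  h.smooth.contDiffAt ((jetDomain T 3).isOpen.mem_nhds hz)

theorem differentiableAt (h : HasFrameValues η F P Q R) (hz : z ∈ jetDomain T 3) :
    DifferentiableAt ℝ η z :=
  (h.contDiffAt hz).differentiableAt (by simp)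

theorem differentiableAt_extDeriv (h : HasFrameValues η F P Q R) (hz : z ∈ jetDomain T 3) :
    DifferentiableAt ℝ (extDeriv η) z :=
  (ContinuousAlternatingMap.alternatizeUncurryFinCLM ℝ (JetCoords m 3) ℝ
    (n := 2)).differentiableAt.comp z
    (((h.contDiffAt hz).fderiv_right (m := ∞) (by simp)).differentiableAt (by simp))

theorem extDeriv_extDeriv_eq_zero (h : HasFrameValues η F P Q R) (hz : z ∈ jetDomain T 3) :
    extDeriv (extDeriv η) z = 0 :=
  extDeriv_extDeriv_apply (h.contDiffAt hz) minSmoothness_real_two_le_infty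

theorem extDeriv_base (h : HasFrameValues η F P Q R) (hz : z ∈ jetDomain T 3) (k l : ℕ)
    (σ : Fin m) :
    extDeriv η z ![cutVec 0 z, cutVec 1 z, coordVec k l σ] =
      (dCut 0 (mixedCoeff F 1 k l σ) - dCut 1 (mixedCoeff F 0 k l σ) + dVert k l σ F).1 z
        + η z ![cutVec 1 z, shift 0 (coordVec k l σ)]
        - η z ![cutVec 0 z, shift 1 (coordVec k l σ)] := by
  have hd := extDeriv_two_apply (h.differentiableAt hz) (hasFDerivAt_cutVec 0 z).differentiableAt
    (hasFDerivAt_cutVec 1 z).differentiableAt (differentiableAt_const (coordVec k l σ))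
  rw [← dCut_apply (fun w hw => (h.mixed w hw 1 k l σ).symm) hz,
    ← dCut_apply (fun w hw => (h.mixed w hw 0 k l σ).symm) hz,
    ← dVert_apply (fun w hw => (h.base w hw).symm) hz, lieBracket_cutVec_cutVec,
    lieBracket_cutVec_const, lieBracket_cutVec_const, form_zero_left, form_neg_left,
    form_neg_left, form_swap (η z) (shift 0 _), form_swap (η z) (shift 1 _)] at hd
  rw [hd]
  simp only [Submodule.coe_add, Submodule.coe_sub, Pi.add_apply, Pi.sub_apply]
  ring

theorem extDeriv_mixed (h : HasFrameValues η F P Q R) (hz : z ∈ jetDomain T 3) (i : Fin 2)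
    (k l : ℕ) (σ : Fin m) (k' l' : ℕ) (ν : Fin m) :
    extDeriv η z ![cutVec i z, coordVec k l σ, coordVec k' l' ν] =
      (dCut i (vertCoeff P Q R k l σ k' l' ν) - dVert k l σ (mixedCoeff F i k' l' ν)
          + dVert k' l' ν (mixedCoeff F i k l σ)).1 z
        + η z ![shift i (coordVec k l σ), coordVec k' l' ν]
        - η z ![shift i (coordVec k' l' ν), coordVec k l σ] := by
  have hd := extDeriv_two_apply (h.differentiableAt hz) (hasFDerivAt_cutVec i z).differentiableAt
    (differentiableAt_const (coordVec k l σ)) (differentiableAt_const (coordVec k' l' ν))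
  rw [← dCut_apply (fun w hw => (h.vert w hw k l σ k' l' ν).symm) hz,
    ← dVert_apply (fun w hw => (h.mixed w hw i k' l' ν).symm) hz,
    ← dVert_apply (fun w hw => (h.mixed w hw i k l σ).symm) hz, lieBracket_cutVec_const,
    lieBracket_cutVec_const, lieBracket_const_const, form_zero_left,
    form_neg_left, form_neg_left] at hd
  rw [hd]
  simp only [Submodule.coe_add, Submodule.coe_sub, Pi.add_apply, Pi.sub_apply]
  ring

theorem extDeriv_vert (h : HasFrameValues η F P Q R) (hz : z ∈ jetDomain T 3) (k l : ℕ)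
    (σ : Fin m) (k' l' : ℕ) (ν : Fin m) (k'' l'' : ℕ) (ρ : Fin m) :
    extDeriv η z ![coordVec k l σ, coordVec k' l' ν, coordVec k'' l'' ρ] =
      (dVert k l σ (vertCoeff P Q R k' l' ν k'' l'' ρ)
        - dVert k' l' ν (vertCoeff P Q R k l σ k'' l'' ρ)
        + dVert k'' l'' ρ (vertCoeff P Q R k l σ k' l' ν)).1 z := by
  have hd := extDeriv_two_apply (h.differentiableAt hz) (differentiableAt_const (coordVec k l σ))
    (differentiableAt_const (coordVec k' l' ν)) (differentiableAt_const (coordVec k'' l'' ρ))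
  rw [← dVert_apply (fun w hw => (h.vert w hw k' l' ν k'' l'' ρ).symm) hz,
    ← dVert_apply (fun w hw => (h.vert w hw k l σ k'' l'' ρ).symm) hz,
    ← dVert_apply (fun w hw => (h.vert w hw k l σ k' l' ν).symm) hz] at hd
  simp only [lieBracket_const_const, form_zero_left, add_zero, sub_zero] at hd
  exact hd

theorem curryLeft_coordVec (h : HasFrameValues η F P Q R) (hz : z ∈ jetDomain T 3) (k l : ℕ)
    (σ : Fin m) : (η z).curryLeft (coordVec (k + 2) l σ) = 0 := by
  refine curryLeft_eq_zero_of_frame (z := z) (fun i => ?_) fun k' l' ν => ?_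
  · rw [form_swap, h.mixed z hz]
    simp [mixedCoeff]
  · rw [h.vert z hz]
    simp [vertCoeff]

end HasFrameValues

end FrameValues

section Closedness

open TopologicalSpace (Opens)

variable {m : ℕ} {T : Opens ((Fin 2 → ℝ) × (Fin m → ℝ))} {F : smoothFn (jetDomain T 3)}

theorem vert_three_dCut {f : smoothFn (jetDomain T 3)} (h3 : ∀ l ρ, dVert 3 l ρ f = 0)
    (h2 : ∀ l ρ, dVert 2 l ρ f = 0) (i : Fin 2) (l : ℕ) (ρ : Fin m) :
    dVert 3 l ρ (dCut i f) = 0 := by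
  match i, l with
  | 0, l => rw [dVert_dCut_zero (by omega), h3, h2, map_zero, add_zero]
  | 1, 0 => rw [dVert_zero_dCut_one, h3, map_zero]
  | 1, l + 1 => rw [dVert_dCut_one (by omega), h3, h2, map_zero, add_zero]

namespace OrderRelations

theorem vert_three_vert_vert (h : OrderRelations F) (l k l' k' l'' : ℕ) (ρ σ ν : Fin m) :
    dVert 3 l ρ (dVert k l' σ (dVert k' l'' ν F)) = 0 := by
  rw [dVert_comm, h.vert_three_vert, map_zero]

theorem vert_three_mixedCoeff (h : OrderRelations F) (l : ℕ) (ρ : Fin m) (i : Fin 2) (k' l' : ℕ)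
    (σ : Fin m) : dVert 3 l ρ (mixedCoeff F i k' l' σ) = 0 := by
  unfold mixedCoeff
  split <;> simp [h.vert_three_momentum, h.vert_three_vert]

theorem vert_three_lepageQ (h : OrderRelations F) (l : ℕ) (ρ : Fin m) (j : Fin 2)
    (σ ν : Fin m) : dVert 3 l ρ (lepageQ F j σ ν) = 0 := by
  have hcut (i : Fin 2) : dVert 3 l ρ (dCut i (dVert 2 1 σ (dVert 2 1 ν F))) = 0 :=
    vert_three_dCut (fun l ρ => h.vert_three_vert_vert ..) (fun l ρ => h.vert_two_hessian ..) i l ρ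
  revert j
  simp [Fin.forall_fin_two, lepageQ_zero, lepageQ_one, h.vert_three_vert_vert, hcut]

theorem vert_three_lepageR (h : OrderRelations F) (l : ℕ) (ρ : Fin m) (i j : Fin 2)
    (σ ν : Fin m) : dVert 3 l ρ (lepageR F i j σ ν) = 0 := by
  revert i j
  simp [Fin.forall_fin_two, lepageR_self, lepageR_zero_one, lepageR_one_zero,
    h.vert_three_vert_vert]

end OrderRelations

namespace TrivialRelations

variable {η : JetCoords m 3 → JetCoords m 3 [⋀^Fin 2]→L[ℝ] ℝ} {z : JetCoords m 3}

theorem vert_three_lepageP (h : TrivialRelations F) (l : ℕ) (ρ σ ν : Fin m) :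
    dVert 3 l ρ (lepageP F σ ν) = 0 := by
  have hcut (i j : Fin 2) (σ ν : Fin m) :
      dVert 3 l ρ (dCut i (dVert 1 j σ (dVert 2 1 ν F) - dVert 1 j ν (dVert 2 1 σ F))) = 0 :=
    vert_three_dCut (fun l ρ => by simp [h.vert_three_vert_vert])
      (fun l ρ => h.vert_two_skew l ρ σ ν j) i l ρ
  have hzero := hcut 0 0 ν σ
  have hone := hcut 1 1 σ ν
  simp only [Fin.val_zero, Fin.val_one, map_sub] at hzero hone
  simp only [lepageP, dSymm_zero_one, map_smul, map_add, map_sub, h.vert_three_vert_vert]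
  linear_combination (norm := module) (1 / 2 : ℝ) • hzero + (1 / 2 : ℝ) • hone

theorem vert_three_vertCoeff (h : TrivialRelations F) (l : ℕ) (ρ : Fin m) (k l' : ℕ) (σ : Fin m)
    (k' l'' : ℕ) (ν : Fin m) :
    dVert 3 l ρ (vertCoeff (lepageP F) (lepageQ F) (lepageR F) k l' σ k' l'' ν) = 0 := by
  unfold vertCoeff
  split <;> simp [h.vert_three_lepageP, h.vert_three_lepageQ, h.vert_three_lepageR]

theorem extDeriv_order (h : TrivialRelations F)
    (hη : HasFrameValues η F (lepageP F) (lepageQ F) (lepageR F)) (hz : z ∈ jetDomain T 3)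
    (l : ℕ) (ρ : Fin m) : (extDeriv η z).curryLeft (coordVec 3 l ρ) = 0 := by
  have hvanish (k l : ℕ) (σ : Fin m) (v : JetCoords m 3) : η z ![coordVec (k + 2) l σ, v] = 0 :=
    DFunLike.congr_fun (hη.curryLeft_coordVec hz k l σ) ![v]
  have hshift (i : Fin 2) (v : JetCoords m 3) : η z ![shift i (coordVec 3 l ρ), v] = 0 := by
    obtain ⟨l', hl'⟩ := shift_coordVec_succ (m := m) (r := 3) (k := 2) i (by omega) l ρ
    rw [hl', hvanish]
  refine form_two_eq_zero_of_frame (z := z) ?_ (fun i k l' σ => ?_) fun k l' σ k' l'' ν => ?_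
  · change extDeriv η z ![coordVec 3 l ρ, cutVec 0 z, cutVec 1 z] = 0
    rw [form_swap, form_swap_right, hη.extDeriv_base hz, form_swap _ (cutVec 1 z),
      form_swap _ (cutVec 0 z), hshift, hshift, h.three]
    simp [mixedCoeff]
  · change extDeriv η z ![coordVec 3 l ρ, cutVec i z, coordVec k l' σ] = 0
    rw [form_swap, hη.extDeriv_mixed hz, hshift, form_swap _ _ (coordVec 3 l ρ), hvanish 1,
      h.vert_three_mixedCoeff]
    simp [vertCoeff, mixedCoeff]
  · change extDeriv η z ![coordVec 3 l ρ, coordVec k l' σ, coordVec k' l'' ν] = 0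
    rw [hη.extDeriv_vert hz, h.vert_three_vertCoeff]
    simp [vertCoeff]

theorem extDeriv_contact (h : TrivialRelations F)
    (hη : HasFrameValues η F (lepageP F) (lepageQ F) (lepageR F)) (hz : z ∈ jetDomain T 3) :
    (contr (extDeriv η) 0 z).curryLeft (cutVec 1 z) = 0 := by
  have hzero (v : JetCoords m 3) : η z ![v, 0] = 0 := (η z).map_coord_zero 1 rfl
  refine curryLeft_eq_zero_of_frame (z := z) (fun i => ?_) fun k l σ => ?_
  · match i with
    | 0 => exact (extDeriv η z).map_eq_zero_of_eq _ (i := 0) (j := 2) rfl (by decide)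
    | 1 => exact (extDeriv η z).map_eq_zero_of_eq _ (i := 1) (j := 2) rfl (by decide)
  · change extDeriv η z ![cutVec 0 z, cutVec 1 z, coordVec k l σ] = 0
    refine coordVec_cases (p := fun u => extDeriv η z ![cutVec 0 z, cutVec 1 z, u] = 0) σ
      ?_ ?_ ?_ ?_ ?_ ?_ (fun l => ?_) k l
    · rw [hη.extDeriv_base hz, shift_coordVec_zero, shift_coordVec_zero, hzero, hzero, h.euler]
      simp [mixedCoeff]
    · rw [hη.extDeriv_base hz, shift_zero_coordVec (by omega), shift_one_coordVec_zero, hzero,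
        hη.mixed z hz]
      simp only [mixedCoeff, momentum_zero, map_neg, map_smul, Submodule.coe_add,
        Submodule.coe_sub, NegMemClass.coe_neg, Submodule.coe_smul, Pi.add_apply, Pi.sub_apply,
        Pi.neg_apply, Pi.smul_apply]
      ring
    · rw [hη.extDeriv_base hz, shift_zero_coordVec (by omega), shift_one_coordVec (by omega),
        coordVec_eq_zero (k := 0) (Or.inr (by omega)), hzero, hη.mixed z hz]
      simp only [mixedCoeff, momentum_one, map_smul, Submodule.coe_add, Submodule.coe_sub,
        Submodule.coe_smul, Pi.add_apply, Pi.sub_apply, Pi.smul_apply, neg_smul, Pi.neg_apply]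
      ring
    · rw [hη.extDeriv_base hz, shift_zero_coordVec (by omega), shift_one_coordVec_zero, hzero,
        hη.mixed z hz]
      simp [mixedCoeff]
    · rw [hη.extDeriv_base hz, shift_zero_coordVec (by omega), shift_one_coordVec (by omega),
        hη.mixed z hz, hη.mixed z hz]
      simp only [mixedCoeff, map_zero, sub_self, zero_add, Submodule.coe_smul, Pi.smul_apply,
        neg_smul]
      ring
    · rw [hη.extDeriv_base hz, shift_zero_coordVec (by omega), shift_one_coordVec (by omega),
        coordVec_eq_zero (k := 1) (Or.inr (by omega)), hzero, hη.mixed z hz]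
      simp [mixedCoeff]
    · exact form_eq_zero_of_curryLeft_eq_zero 2 (h.extDeriv_order hη hz l σ)

theorem contr_extDeriv_cutVec (h : TrivialRelations F)
    (hη : HasFrameValues η F (lepageP F) (lepageQ F) (lepageR F)) (hz : z ∈ jetDomain T 3)
    (u : JetCoords m 3) (i : Fin 2) : contr (extDeriv η) 0 z ![u, cutVec i z] = 0 := by
  match i with
  | 0 => exact (extDeriv η z).map_eq_zero_of_eq _ (i := 0) (j := 2) rfl (by decide)
  | 1 =>
    rw [form_swap, neg_eq_zero]
    exact DFunLike.congr_fun (h.extDeriv_contact hη hz) ![u]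

theorem extDeriv_two_zero (h : TrivialRelations F)
    (hη : HasFrameValues η F (lepageP F) (lepageQ F) (lepageR F)) (hz : z ∈ jetDomain T 3)
    (σ : Fin m) : (contr (extDeriv η) 0 z).curryLeft (coordVec 2 0 σ) = 0 := by
  refine curryLeft_eq_zero_of_frame (h.contr_extDeriv_cutVec hη hz _) fun k l ν => ?_
  refine coordVec_cases (p := fun u => extDeriv η z ![cutVec 0 z, coordVec 2 0 σ, u] = 0) ν
    ?_ ?_ ?_ ?_ ?_ ?_ (fun l => ?_) k l
  · have hmom := congrArg (fun f => f.1 z) (h.vert_two_zero_momentum_add_lepageQ σ ν)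
    rw [hη.extDeriv_mixed hz, shift_coordVec_zero, form_zero_left, shift_zero_coordVec (by omega),
      hη.vert z hz]
    simp only [mixedCoeff, vertCoeff, map_zero, zero_sub, add_zero, sub_zero, Submodule.coe_add,
      Submodule.coe_zero, NegMemClass.coe_neg, Pi.add_apply, Pi.zero_apply, Pi.neg_apply] at hmom ⊢
    linarith
  · rw [hη.extDeriv_mixed hz, shift_zero_coordVec (by omega), shift_zero_coordVec (by omega),
      hη.vert z hz, hη.vert z hz]
    simp [mixedCoeff, vertCoeff, lepageR_self, h.vert_two_zero_one]
  · rw [hη.extDeriv_mixed hz, shift_zero_coordVec (by omega), shift_zero_coordVec (by omega),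
      hη.vert z hz, hη.vert z hz]
    simp [mixedCoeff, vertCoeff, lepageR_zero_one, h.vert_two_zero_two]
  all_goals
    rw [hη.extDeriv_mixed hz, shift_zero_coordVec (by omega), shift_zero_coordVec (by omega),
      hη.vert z hz, hη.vert z hz]
    simp [mixedCoeff, vertCoeff]

theorem extDeriv_two_one (h : TrivialRelations F)
    (hη : HasFrameValues η F (lepageP F) (lepageQ F) (lepageR F)) (hz : z ∈ jetDomain T 3)
    (σ : Fin m) : (contr (extDeriv η) 0 z).curryLeft (coordVec 2 1 σ) = 0 := by
  refine curryLeft_eq_zero_of_frame (h.contr_extDeriv_cutVec hη hz _) fun k l ν => ?_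
  refine coordVec_cases (p := fun u => extDeriv η z ![cutVec 0 z, coordVec 2 1 σ, u] = 0) ν
    ?_ ?_ ?_ ?_ ?_ ?_ (fun l => ?_) k l
  · have hmom := congrArg (fun f => f.1 z) (h.vert_two_one_momentum_add_lepageQ σ ν)
    rw [hη.extDeriv_mixed hz, shift_coordVec_zero, form_zero_left, shift_zero_coordVec (by omega),
      hη.vert z hz]
    simp only [mixedCoeff, vertCoeff, map_zero, zero_sub, add_zero, sub_zero, Submodule.coe_add,
      Submodule.coe_zero, NegMemClass.coe_neg, Pi.add_apply, Pi.zero_apply, Pi.neg_apply] at hmom ⊢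
    linarith
  · rw [hη.extDeriv_mixed hz, shift_zero_coordVec (by omega), shift_zero_coordVec (by omega),
      hη.vert z hz, hη.vert z hz]
    simp [mixedCoeff, vertCoeff, lepageR_one_zero]
  · rw [hη.extDeriv_mixed hz, shift_zero_coordVec (by omega), shift_zero_coordVec (by omega),
      hη.vert z hz, hη.vert z hz]
    simp [mixedCoeff, vertCoeff, lepageR_self, h.vert_two_one_two]
  all_goals
    rw [hη.extDeriv_mixed hz, shift_zero_coordVec (by omega), shift_zero_coordVec (by omega),
      hη.vert z hz, hη.vert z hz]
    simp [mixedCoeff, vertCoeff]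

theorem extDeriv_one_zero_one_zero (h : TrivialRelations F)
    (hη : HasFrameValues η F (lepageP F) (lepageQ F) (lepageR F)) (hz : z ∈ jetDomain T 3)
    (σ ν : Fin m) : contr (extDeriv η) 0 z ![coordVec 1 0 σ, coordVec 1 0 ν] = 0 := by
  have hskew := congrArg (fun f => f.1 z) (h.lepageQ_zero_skew σ ν)
  change extDeriv η z ![cutVec 0 z, coordVec 1 0 σ, coordVec 1 0 ν] = 0
  rw [hη.extDeriv_mixed hz, shift_zero_coordVec (by omega), shift_zero_coordVec (by omega),
    hη.vert z hz, hη.vert z hz]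
  simp only [mixedCoeff, vertCoeff, lepageR_self, map_zero, map_smul, zero_sub, Submodule.coe_add,
    Submodule.coe_sub, Submodule.coe_smul, NegMemClass.coe_neg, Pi.add_apply, Pi.sub_apply,
    Pi.smul_apply, Pi.neg_apply] at hskew ⊢
  linarith

theorem extDeriv_one_zero_symm (h : TrivialRelations F)
    (hη : HasFrameValues η F (lepageP F) (lepageQ F) (lepageR F)) (hz : z ∈ jetDomain T 3)
    (σ ν : Fin m) : contr (extDeriv η) 0 z ![coordVec 1 0 σ, coordVec 0 0 ν] =
      contr (extDeriv η) 0 z ![coordVec 1 0 ν, coordVec 0 0 σ] := by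
  have hP := congrArg (fun f => f.1 z) (h.lepageP_eq σ ν)
  change extDeriv η z ![cutVec 0 z, coordVec 1 0 σ, coordVec 0 0 ν] =
    extDeriv η z ![cutVec 0 z, coordVec 1 0 ν, coordVec 0 0 σ]
  rw [hη.extDeriv_mixed hz, hη.extDeriv_mixed hz, shift_zero_coordVec (by omega),
    shift_zero_coordVec (by omega), shift_coordVec_zero, shift_coordVec_zero, form_zero_left,
    form_zero_left, hη.vert z hz, hη.vert z hz]
  simp only [mixedCoeff, vertCoeff, map_neg, map_smul, sub_zero, Submodule.coe_add,
    Submodule.coe_sub, Submodule.coe_smul, NegMemClass.coe_neg, Pi.add_apply, Pi.sub_apply,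
    Pi.smul_apply, Pi.neg_apply] at hP ⊢
  linarith

theorem extDeriv_eq_zero (h : TrivialRelations F)
    (hη : HasFrameValues η F (lepageP F) (lepageQ F) (lepageR F)) :
    ∀ z ∈ jetDomain T 3, extDeriv η z = 0 :=
  IsClosedContact.eq_zero (ρ := extDeriv η)
    { differentiableAt := fun _ hz => hη.differentiableAt_extDeriv hz
      closed := fun _ hz => hη.extDeriv_extDeriv_eq_zero hz
      contact := fun _ hz => h.extDeriv_contact hη hz
      order := fun _ hz l σ => h.extDeriv_order hη hz l σ }
    (fun _ hz σ => h.extDeriv_two_zero hη hz σ) (fun _ hz σ => h.extDeriv_two_one hη hz σ)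
    (fun _ hz σ ν => h.extDeriv_one_zero_one_zero hη hz σ ν)
    (fun _ hz σ ν => h.extDeriv_one_zero_symm hη hz σ ν)

end TrivialRelations

end Closedness

section Ansatz

open TopologicalSpace (Opens)

variable {m r : ℕ} {T : Opens ((Fin 2 → ℝ) × (Fin m → ℝ))} {F : smoothFn (jetDomain T 3)}
  {L : JetCoords m 2 → ℝ}

namespace IsPullback

variable {a : smoothFn (jetDomain T 3)} {f : JetCoords m 2 → ℝ}

theorem dY (ha : IsPullback a f) (σ : Fin m) : IsPullback (dVert 0 0 σ a) (dY σ f) := by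
  unfold FundLepage.dY
  simpa only [vecY_eq_coordVec] using ha.vert 0 0 σ

theorem dY1 (ha : IsPullback a f) (j : Fin 2) (σ : Fin m) :
    IsPullback (dVert 1 j σ a) (dY1 j σ f) := by
  unfold FundLepage.dY1
  simpa only [vecY_eq_coordVec] using ha.vert 1 j σ

theorem dY2 (ha : IsPullback a f) (i j : Fin 2) (σ : Fin m) :
    IsPullback (dSymm i j σ a) (dY2 i j σ f) := by
  unfold FundLepage.dY2
  simpa only [vecY_eq_coordVec, dSymm, LinearMap.smul_apply] using
    (ha.vert 2 (i + j : ℕ) σ).smul (if i = j then 1 else 1 / 2)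

theorem momentum_apply (hF : IsPullback F L) (j : Fin 2) (σ : Fin m) {z : JetCoords m 3}
    (hz : z ∈ jetDomain T 3) :
    (momentum F j σ).1 z =
      FundLepage.dY1 j σ L (proj z) - ∑ i, formalD i (FundLepage.dY2 i j σ L) z := by
  simp [momentum, Fin.sum_univ_two, (hF.dY1 j σ).2 z hz, (hF.dY2 _ j σ).cut_apply _ hz]

end IsPullback

theorem dx_coordVec (i : Fin 2) (k l : ℕ) (ν : Fin m) :
    (dx i : JetCoords m r →L[ℝ] ℝ) (coordVec k l ν) = 0 := rfl

theorem dx_cutVec (i j : Fin 2) (z : JetCoords m r) :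
    (dx i : JetCoords m r →L[ℝ] ℝ) (cutVec j z) = if i = j then 1 else 0 := by
  simp [dx, cutVec, Pi.single_apply]

theorem omegaBase_coordVec (i : Fin 2) (k l : ℕ) (ν : Fin m) :
    (omegaBase i : JetCoords m r →L[ℝ] ℝ) (coordVec k l ν) = 0 := by
  unfold omegaBase
  split_ifs <;> simp [dx_coordVec]

theorem omegaBase_cutVec (i j : Fin 2) (z : JetCoords m r) :
    (omegaBase j : JetCoords m r →L[ℝ] ℝ) (cutVec i z) =
      if j = 0 then (if i = 1 then 1 else 0) else (if i = 0 then -1 else 0) := by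
  unfold omegaBase
  split_ifs <;> simp_all [dx_cutVec, eq_comm]

theorem contact_cutVec (k l : ℕ) (hk : k < r) (hl : l < k + 1) (σ : Fin m)
    (z : JetCoords m r) (i : Fin 2) : contact k l hk hl σ z (cutVec i z) = 0 := by
  have hdy : (dyForm k l (by omega) hl σ : JetCoords m r →L[ℝ] ℝ) (cutVec i z) =
      z.2 ⟨k + 1, by omega⟩ ⟨l + (i : ℕ), by simp only; omega⟩ σ := by
    simp [dyForm, cutVec, hk]
  simp [contact, hdy, dx_cutVec, -Fin.sum_univ_two]

theorem contact_coordVec (k l : ℕ) (hk : k < r) (hl : l < k + 1) (σ : Fin m)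
    (z : JetCoords m r) (k' l' : ℕ) (ν : Fin m) :
    contact k l hk hl σ z (coordVec k' l' ν) = if k = k' ∧ l = l' ∧ σ = ν then 1 else 0 := by
  have hdy : (dyForm k l (by omega) hl σ : JetCoords m r →L[ℝ] ℝ) (coordVec k' l' ν) =
      if k = k' ∧ l = l' ∧ σ = ν then 1 else 0 := rfl
  simp [contact, hdy, dx_coordVec]

theorem om_cutVec (σ : Fin m) (z : JetCoords m 3) (i : Fin 2) : om σ z (cutVec i z) = 0 :=
  contact_cutVec ..

theorem om1_cutVec (j : Fin 2) (σ : Fin m) (z : JetCoords m 3) (i : Fin 2) :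
    om1 j σ z (cutVec i z) = 0 :=
  contact_cutVec ..

theorem om_coordVec (σ : Fin m) (z : JetCoords m 3) (k l : ℕ) (ν : Fin m) :
    om σ z (coordVec k l ν) = if 0 = k ∧ 0 = l ∧ σ = ν then 1 else 0 :=
  contact_coordVec ..

theorem om1_coordVec (j : Fin 2) (σ : Fin m) (z : JetCoords m 3) (k l : ℕ) (ν : Fin m) :
    om1 j σ z (coordVec k l ν) = if 1 = k ∧ (j : ℕ) = l ∧ σ = ν then 1 else 0 :=
  contact_coordVec ..

theorem ansatz_base (L : JetCoords m 2 → ℝ) (K : Coeffs m) (z : JetCoords m 3) :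
    ansatz L K z ![cutVec 0 z, cutVec 1 z] = L (proj z) := by
  simp [ansatz, poincareCartan, wedge_apply, om_cutVec, om1_cutVec, dx_cutVec]

theorem ansatz_mixed (hF : IsPullback F L) (K : Coeffs m) {z : JetCoords m 3}
    (hz : z ∈ jetDomain T 3) (i : Fin 2) (k l : ℕ) (σ : Fin m) :
    ansatz L K z ![cutVec i z, coordVec k l σ] = (mixedCoeff F i k l σ).1 z := by
  simp only [ansatz, poincareCartan, ← hF.momentum_apply _ _ hz, ← (hF.dY2 _ _ _).2 z hz,
    wedge_apply, om_cutVec, om1_cutVec, dx_coordVec,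
    omegaBase_coordVec, om_coordVec, om1_coordVec, ContinuousAlternatingMap.add_apply,
    ContinuousAlternatingMap.smul_apply, ContinuousAlternatingMap.sum_apply, smul_eq_mul,
    Matrix.cons_val_zero, Matrix.cons_val_one, mul_zero, zero_mul, sub_zero, zero_sub,
    Finset.sum_const_zero, add_zero, zero_add, omegaBase_cutVec]
  revert i
  rcases k with _ | _ | k <;> rcases l with _ | _ | l <;>
    simp [Fin.forall_fin_two, mixedCoeff, dSymm_zero_zero, dSymm_zero_one, dSymm_one_zero,
      dSymm_one_one]

theorem ansatz_vert {K : Coeffs m} {P : Fin m → Fin m → smoothFn (jetDomain T 3)}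
    {Q : Fin 2 → Fin m → Fin m → smoothFn (jetDomain T 3)}
    {R : Fin 2 → Fin 2 → Fin m → Fin m → smoothFn (jetDomain T 3)}
    (hK : K.Admissible (jetDomain T 3)) {z : JetCoords m 3} (hz : z ∈ jetDomain T 3)
    (hP : ∀ σ ν, K.P σ ν z = (P σ ν).1 z) (hQ : ∀ j σ ν, K.Q j σ ν z = (Q j σ ν).1 z)
    (hR : ∀ i j σ ν, K.R i j σ ν z = (R i j σ ν).1 z)
    (k l : ℕ) (σ : Fin m) (k' l' : ℕ) (ν : Fin m) :
    ansatz L K z ![coordVec k l σ, coordVec k' l' ν] = (vertCoeff P Q R k l σ k' l' ν).1 z := by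
  have skewP := hK.skew_P ν σ z hz
  have skewR (i j : Fin 2) := hK.skew_R i j ν σ z hz
  simp only [hP, hR, Fin.forall_fin_two] at skewP skewR
  simp only [ansatz, poincareCartan, wedge_apply, dx_coordVec, omegaBase_coordVec, om_coordVec,
    om1_coordVec, ContinuousAlternatingMap.add_apply, ContinuousAlternatingMap.smul_apply,
    ContinuousAlternatingMap.sum_apply, smul_eq_mul, Matrix.cons_val_zero, Matrix.cons_val_one,
    mul_zero, sub_zero, Finset.sum_const_zero, zero_add, hP, hQ, hR, mul_sub,
    Finset.sum_sub_distrib]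
  rcases k with _ | _ | k <;> rcases l with _ | _ | l <;> rcases k' with _ | _ | k' <;>
    rcases l' with _ | _ | l' <;> simp [vertCoeff] <;> linarith

theorem isBilinearMap_wedge (E : Type*) [NormedAddCommGroup E] [NormedSpace ℝ E] :
    IsBilinearMap ℝ (wedge : (E →L[ℝ] ℝ) → (E →L[ℝ] ℝ) → E [⋀^Fin 2]→L[ℝ] ℝ) := by
  constructor <;> intros <;> ext v <;> simp [wedge_apply] <;> ring

theorem contDiff_wedge {E : Type*} [NormedAddCommGroup E] [NormedSpace ℝ E]
    [FiniteDimensional ℝ E] {α β : E → E →L[ℝ] ℝ} (hα : ContDiff ℝ ∞ α) (hβ : ContDiff ℝ ∞ β) :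
    ContDiff ℝ ∞ fun z => wedge (α z) (β z) := by
  have h := ((isBilinearMap_wedge E).toContinuousBilinearMap.contDiff.comp hα).clm_apply hβ
  exact h

theorem contDiff_contact (k l : ℕ) (hk : k < r) (hl : l < k + 1) (σ : Fin m) :
    ContDiff ℝ ∞ fun z : JetCoords m r => contact k l hk hl σ z :=
  contDiff_const.sub (ContDiff.sum fun i _ =>
    (dyForm (k + 1) (l + (i : ℕ)) (by omega) (by omega) σ).contDiff.smul contDiff_const)

theorem contDiff_om (σ : Fin m) : ContDiff ℝ ∞ (om σ) := contDiff_contact ..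

theorem contDiff_om1 (j : Fin 2) (σ : Fin m) : ContDiff ℝ ∞ (om1 j σ) := contDiff_contact ..

theorem contDiffOn_smul_wedge {E : Type*} [NormedAddCommGroup E] [NormedSpace ℝ E]
    [FiniteDimensional ℝ E] {D : Set E} {α β : E → E →L[ℝ] ℝ} {f : E → ℝ}
    (hf : ContDiffOn ℝ ∞ f D) (hα : ContDiff ℝ ∞ α) (hβ : ContDiff ℝ ∞ β) :
    ContDiffOn ℝ ∞ (fun z => f z • wedge (α z) (β z)) D :=
  hf.smul (contDiff_wedge hα hβ).contDiffOn

theorem contDiffOn_poincareCartan (hF : IsPullback F L) :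
    ContDiffOn ℝ ∞ (poincareCartan L) (jetDomain T 3) := by
  refine ContDiffOn.add (ContDiffOn.add
    (contDiffOn_smul_wedge (contDiffOn_comp_proj hF.1) contDiff_const contDiff_const) ?_) ?_
  · exact ContDiffOn.sum fun σ _ => ContDiffOn.sum fun j _ => contDiffOn_smul_wedge
      ((momentum F j σ).2.1.congr fun z hz => (hF.momentum_apply j σ hz).symm)
      (contDiff_om σ) contDiff_const
  · exact ContDiffOn.sum fun σ _ => ContDiffOn.sum fun i _ => ContDiffOn.sum fun j _ =>
      contDiffOn_smul_wedge (contDiffOn_comp_proj (hF.dY2 i j σ).1) (contDiff_om1 i σ)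
        contDiff_const

theorem contDiffOn_ansatz (hF : IsPullback F L) {K : Coeffs m}
    (hK : K.Admissible (jetDomain T 3)) : ContDiffOn ℝ ∞ (ansatz L K) (jetDomain T 3) := by
  refine ContDiffOn.add (ContDiffOn.add (ContDiffOn.add (contDiffOn_poincareCartan hF) ?_) ?_) ?_
  · exact ContDiffOn.sum fun σ _ => ContDiffOn.sum fun ν _ => contDiffOn_smul_wedge
      (contDiffOn_const.mul (hK.smooth_P σ ν)) (contDiff_om σ) (contDiff_om ν)
  · exact ContDiffOn.sum fun j _ => ContDiffOn.sum fun σ _ => ContDiffOn.sum fun ν _ =>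
      contDiffOn_smul_wedge (hK.smooth_Q j σ ν) (contDiff_om σ) (contDiff_om1 j ν)
  · exact ContDiffOn.sum fun i _ => ContDiffOn.sum fun j _ => ContDiffOn.sum fun σ _ =>
      ContDiffOn.sum fun ν _ => contDiffOn_smul_wedge
        (contDiffOn_const.mul (hK.smooth_R i j σ ν)) (contDiff_om1 i σ) (contDiff_om1 j ν)

theorem hasFrameValues_ansatz (hF : IsPullback F L) {K : Coeffs m}
    (hK : K.Admissible (jetDomain T 3)) {P : Fin m → Fin m → smoothFn (jetDomain T 3)}
    {Q : Fin 2 → Fin m → Fin m → smoothFn (jetDomain T 3)}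
    {R : Fin 2 → Fin 2 → Fin m → Fin m → smoothFn (jetDomain T 3)}
    (hP : ∀ z ∈ jetDomain T 3, ∀ σ ν, K.P σ ν z = (P σ ν).1 z)
    (hQ : ∀ z ∈ jetDomain T 3, ∀ j σ ν, K.Q j σ ν z = (Q j σ ν).1 z)
    (hR : ∀ z ∈ jetDomain T 3, ∀ i j σ ν, K.R i j σ ν z = (R i j σ ν).1 z) :
    HasFrameValues (ansatz L K) F P Q R where
  smooth := contDiffOn_ansatz hF hK
  base z hz := (ansatz_base L K z).trans (hF.2 z hz).symm
  mixed _ hz := ansatz_mixed hF K hz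
  vert z hz := ansatz_vert hK hz (hP z hz) (hQ z hz) (hR z hz)

theorem hasFrameValues_ansatz_restr (hF : IsPullback F L) {K : Coeffs m}
    (hK : K.Admissible (jetDomain T 3)) :
    HasFrameValues (ansatz L K) F (fun σ ν => restr (K.P σ ν) (hK.smooth_P σ ν))
      (fun j σ ν => restr (K.Q j σ ν) (hK.smooth_Q j σ ν))
      (fun i j σ ν => restr (K.R i j σ ν) (hK.smooth_R i j σ ν)) :=
  hasFrameValues_ansatz hF hK (fun _ hz _ _ => (restr_apply _ hz).symm)
    (fun _ hz _ _ _ => (restr_apply _ hz).symm) fun _ hz _ _ _ _ => (restr_apply _ hz).symm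

end Ansatz

section Fundamental

open TopologicalSpace (Opens)

variable {m : ℕ} {T : Opens ((Fin 2 → ℝ) × (Fin m → ℝ))} {F : smoothFn (jetDomain T 3)}
  {L : JetCoords m 2 → ℝ}

theorem HasFrameValues.eqOn_of_extDeriv_eqOn
    {η η' : JetCoords m 3 → JetCoords m 3 [⋀^Fin 2]→L[ℝ] ℝ}
    {P P' : Fin m → Fin m → smoothFn (jetDomain T 3)}
    {Q Q' : Fin 2 → Fin m → Fin m → smoothFn (jetDomain T 3)}
    {R R' : Fin 2 → Fin 2 → Fin m → Fin m → smoothFn (jetDomain T 3)}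
    (h : HasFrameValues η F P Q R) (h' : HasFrameValues η' F P' Q' R')
    (hd : Set.EqOn (extDeriv η) (extDeriv η') (jetDomain T 3)) :
    Set.EqOn η η' (jetDomain T 3) := by
  suffices hzero : ∀ z ∈ jetDomain T 3, (η - η') z = 0 from fun z hz => sub_eq_zero.1 (hzero z hz)
  refine form_eq_zero_of_extDeriv_eq_zero (fun z hz => ?_) (fun z hz => ?_) (fun z hz => ?_)
    fun z hz l σ => ?_
  · exact (h.differentiableAt hz).sub (h'.differentiableAt hz)
  · rw [extDeriv, fderiv_sub (h.differentiableAt hz) (h'.differentiableAt hz)]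
    exact (map_sub (ContinuousAlternatingMap.alternatizeUncurryFinCLM ℝ _ ℝ) _ _).trans
      (sub_eq_zero.2 (hd hz))
  · refine curryLeft_eq_zero_of_frame (z := z) (Fin.forall_fin_two.2 ⟨?_, ?_⟩) fun k l σ => ?_
    · exact ((η - η') z).map_eq_zero_of_eq _ (i := 0) (j := 1) rfl zero_ne_one
    · exact sub_eq_zero.2 ((h.base z hz).trans (h'.base z hz).symm)
    · exact sub_eq_zero.2 ((h.mixed z hz 0 k l σ).trans (h'.mixed z hz 0 k l σ).symm)
  · have hcurry := congrArg₂ (· - ·) (h.curryLeft_coordVec hz 1 l σ)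
      (h'.curryLeft_coordVec hz 1 l σ)
    rw [sub_self] at hcurry
    exact hcurry

theorem coeffs_eqOn_of_ansatz_eqOn (hF : IsPullback F L) {K K' : Coeffs m}
    (hK : K.Admissible (jetDomain T 3)) (hK' : K'.Admissible (jetDomain T 3))
    (h : Set.EqOn (ansatz L K) (ansatz L K') (jetDomain T 3)) :
    K.EqOn K' (jetDomain T 3) := by
  intro z hz
  have hvert (k l : ℕ) (σ : Fin m) (k' l' : ℕ) (ν : Fin m) :=
    ((hasFrameValues_ansatz_restr hF hK).vert z hz k l σ k' l' ν).symm.trans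
      ((congrArg (fun α => α ![coordVec k l σ, coordVec k' l' ν]) (h hz)).trans
        ((hasFrameValues_ansatz_restr hF hK').vert z hz k l σ k' l' ν))
  refine ⟨fun σ ν => ?_, fun j σ ν => ?_, fun i j σ ν => ?_⟩
  · simpa [vertCoeff, restr_apply _ hz] using hvert 0 0 σ 0 0 ν
  · have hQ := hvert 0 0 σ 1 j ν
    revert j
    simp [Fin.forall_fin_two, vertCoeff, restr_apply _ hz]
  · have hR := hvert 1 i σ 1 j ν
    revert i j
    simp [Fin.forall_fin_two, vertCoeff, restr_apply _ hz]

theorem IsPullback.orderRelations (hF : IsPullback F L)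
    (h : ∀ z ∈ jetDomain T 2, OrderConditionAt L z) : OrderRelations F where
  three := hF.vert_top
  cyclic p q i j σ ν := by
    ext z hz
    exact (((((hF.dY2 i j σ).dY2 p q ν).add ((hF.dY2 q j σ).dY2 i p ν)).add
      ((hF.dY2 p j σ).dY2 q i ν)).2 z hz).trans (h _ (proj_mem hz) p q i j σ ν)

/-- The point of `J^{r+1} Y` over a point of `J^r Y` whose coordinates of order `r + 1` vanish. At
such points the formal derivatives are the cut ones. -/
def zeroLift {r : ℕ} (z : JetCoords m r) : JetCoords m (r + 1) :=
  (z.1, fun k l σ => if h : (k : ℕ) < r + 1 then z.2 ⟨k, h⟩ l σ else 0)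

theorem proj_zeroLift {r : ℕ} (z : JetCoords m r) : proj (zeroLift z) = z := by
  refine Prod.ext rfl ?_
  funext k l σ
  simp only [proj, zeroLift, Fin.val_castSucc, k.isLt, dite_true]

theorem zeroLift_mem {r : ℕ} {z : JetCoords m r} (hz : z ∈ jetDomain T r) :
    zeroLift z ∈ jetDomain T (r + 1) :=
  hz

theorem formalVec_zeroLift {r : ℕ} (i : Fin 2) (z : JetCoords m r) :
    formalVec i (zeroLift z) = cutVec i z := by
  refine Prod.ext rfl ?_
  funext k l σ
  by_cases h : (k : ℕ) < r <;> simp [formalVec, zeroLift, cutVec, h]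

theorem formalD_zeroLift {r : ℕ} (i : Fin 2) {f : JetCoords m r → ℝ}
    {a : smoothFn (jetDomain T r)} (ha : Set.EqOn a.1 f (jetDomain T r)) {z : JetCoords m r}
    (hz : z ∈ jetDomain T r) : formalD i f (zeroLift z) = (dCut i a).1 z := by
  rw [formalD, proj_zeroLift, formalVec_zeroLift, dCut_apply ha hz]

theorem eulerLagrange_zeroLift (hF : IsPullback F L) (σ : Fin m) {z : JetCoords m 3}
    (hz : z ∈ jetDomain T 3) :
    eulerLagrange L σ (zeroLift z) =
      (dVert 0 0 σ F - ∑ i, dCut i (momentum F i σ)).1 z := by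
  have hsecond (i j : Fin 2) : formalD i (formalD j (dY2 i j σ L)) (zeroLift z) =
      (dCut i (dCut j (dSymm j i σ F))).1 z := by
    rw [dSymm_symm]
    exact formalD_zeroLift i (fun w hw => (hF.dY2 i j σ).cut_apply j hw) hz
  simp only [eulerLagrange, hsecond, proj_zeroLift, ← (hF.dY σ).2 z hz,
    ← (hF.dY1 _ σ).cut_apply _ hz, Fin.sum_univ_two, momentum, map_sub, map_add,
    Submodule.coe_sub, Submodule.coe_add, Pi.sub_apply, Pi.add_apply]
  ring

theorem IsPullback.trivialRelations (hF : IsPullback F L)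
    (h : ∀ z ∈ jetDomain T 2, OrderConditionAt L z)
    (hE : ∀ z ∈ jetDomain T 4, ∀ σ, eulerLagrange L σ z = 0) : TrivialRelations F where
  toOrderRelations := hF.orderRelations h
  euler σ := by
    rw [← sub_eq_zero]
    ext z hz
    rw [← eulerLagrange_zeroLift hF σ hz]
    exact hE _ (zeroLift_mem hz) σ

theorem IsPullback.lepageP (hF : IsPullback F L) (h : TrivialRelations F) (σ ν : Fin m) :
    IsPullback (lepageP F σ ν) (fundP L σ ν) := by
  have htop (j : Fin 2) (σ ν : Fin m) (l : ℕ) (ρ : Fin m) :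
      dVert 2 l ρ (dVert 1 j σ (dSymm 0 1 ν F) - dVert 1 j ν (dSymm 0 1 σ F)) = 0 := by
    rw [dSymm_zero_one, dSymm_zero_one, map_smul, map_smul,
      ← smul_sub (1 / 2 : ℝ) (dVert 1 j σ (dVert 2 1 ν F)) (dVert 1 j ν (dVert 2 1 σ F)), map_smul,
      h.vert_two_skew, smul_zero]
  exact (((((hF.dY1 1 ν).dY1 0 σ).sub ((hF.dY1 1 σ).dY1 0 ν)).smul (1 / 2)).add
    ((((hF.dY2 0 1 σ).dY1 0 ν).sub ((hF.dY2 0 1 ν).dY1 0 σ)).cut (htop 0 ν σ) 0)).add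
    ((((hF.dY2 0 1 ν).dY1 1 σ).sub ((hF.dY2 0 1 σ).dY1 1 ν)).cut (htop 1 σ ν) 1)

theorem IsPullback.lepageQ (hF : IsPullback F L) (h : OrderRelations F) (j : Fin 2)
    (σ ν : Fin m) : IsPullback (lepageQ F j σ ν) (fundQ L j σ ν) := by
  have hcut (i : Fin 2) := ((hF.dY2 0 1 ν).dY2 0 1 σ).cut
    (fun l ρ => by simp only [dSymm_zero_one, map_smul, h.vert_two_hessian, smul_zero]) i
  unfold FundLepage.lepageQ fundQ
  split_ifs
  · exact (((((hF.dY2 0 1 ν).dY1 0 σ).smul 2).sub ((hF.dY2 0 1 σ).dY1 0 ν)).sub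
      ((hF.dY2 0 0 σ).dY1 1 ν)).sub ((hcut 1).smul 2)
  · exact (((((hF.dY2 0 1 ν).dY1 1 σ).smul (-2)).add ((hF.dY2 1 1 σ).dY1 0 ν)).add
      ((hF.dY2 0 1 σ).dY1 1 ν)).add ((hcut 0).smul 2)

theorem IsPullback.lepageR (hF : IsPullback F L) (i j : Fin 2) (σ ν : Fin m) :
    IsPullback (lepageR F i j σ ν) (fundR L i j σ ν) := by
  have hmixed := (hF.dY2 0 1 ν).dY2 0 1 σ
  unfold FundLepage.lepageR fundR
  split_ifs
  · exact ⟨contDiffOn_const, fun _ _ => rfl⟩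
  · exact hmixed.smul (-2)
  · exact hmixed.smul 2

theorem contDiffOn_fundP (hF : IsPullback F L) (σ ν : Fin m) :
    ContDiffOn ℝ ∞ (fundP L σ ν) (jetDomain T 2) := by
  have hmixed (j : Fin 2) (σ ν : Fin m) :=
    (((hF.dY2 0 1 σ).dY1 j ν).sub ((hF.dY2 0 1 ν).dY1 j σ)).1
  exact ((((((hF.dY1 1 ν).dY1 0 σ).sub ((hF.dY1 1 σ).dY1 0 ν)).smul (1 / 2)).1).add
    (contDiffOn_cutD (hmixed 0 σ ν) 0)).add (contDiffOn_cutD (hmixed 1 ν σ) 1)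

theorem contDiffOn_fundQ (hF : IsPullback F L) (j : Fin 2) (σ ν : Fin m) :
    ContDiffOn ℝ ∞ (fundQ L j σ ν) (jetDomain T 2) := by
  have hcut (i : Fin 2) : ContDiffOn ℝ ∞ (fun z => 2 * cutD i (dY2 0 1 σ (dY2 0 1 ν L)) z)
      (jetDomain T 2) :=
    contDiffOn_const.mul (contDiffOn_cutD ((hF.dY2 0 1 ν).dY2 0 1 σ).1 i)
  unfold fundQ
  split_ifs
  · exact ((((((hF.dY2 0 1 ν).dY1 0 σ).smul 2).sub ((hF.dY2 0 1 σ).dY1 0 ν)).sub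
      ((hF.dY2 0 0 σ).dY1 1 ν)).1).sub (hcut 1)
  · exact ((((((hF.dY2 0 1 ν).dY1 1 σ).smul (-2)).add ((hF.dY2 1 1 σ).dY1 0 ν)).add
      ((hF.dY2 0 1 σ).dY1 1 ν)).1).add (hcut 0)

theorem fundP_skew (L : JetCoords m 2 → ℝ) (σ ν : Fin m) (z : JetCoords m 2) :
    fundP L σ ν z = -fundP L ν σ z := by
  have hcut (i : Fin 2) (f g : JetCoords m 2 → ℝ) :
      cutD i (fun w => f w - g w) z = -cutD i (fun w => g w - f w) z := by
    simp only [cutD, ← neg_apply, ← fderiv_fun_neg, neg_sub]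
  rw [fundP, fundP, hcut 0, hcut 1]
  ring

theorem lepageR_skew (F : smoothFn (jetDomain T 3)) (i j : Fin 2) (σ ν : Fin m) :
    lepageR F i j σ ν = -lepageR F j i ν σ := by
  revert i j
  simp [Fin.forall_fin_two, lepageR_self, lepageR_zero_one, lepageR_one_zero,
    dVert_comm 2 1 2 1 ν σ]
  constructor <;> module

theorem admissible_fundCoeffs (hF : IsPullback F L) :
    (fundCoeffs L).Admissible (jetDomain T 3) where
  smooth_P σ ν := contDiffOn_comp_proj (contDiffOn_fundP hF σ ν)
  smooth_Q j σ ν := contDiffOn_comp_proj (contDiffOn_fundQ hF j σ ν)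
  smooth_R i j σ ν := contDiffOn_comp_proj (hF.lepageR i j σ ν).1
  skew_P σ ν z _ := fundP_skew L σ ν (proj z)
  skew_R i j σ ν z hz := by
    simp only [fundCoeffs, ← (hF.lepageR _ _ _ _).2 z hz]
    rw [lepageR_skew]
    rfl

theorem extDeriv_ansatz_eq_zero (hF : IsPullback F L) (h : TrivialRelations F) {K : Coeffs m}
    (hK : K.Admissible (jetDomain T 3)) (hKL : K.EqOn (fundCoeffs L) (jetDomain T 3)) :
    ∀ z ∈ jetDomain T 3, extDeriv (ansatz L K) z = 0 :=
  h.extDeriv_eq_zero (hasFrameValues_ansatz hF hK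
    (fun z hz σ ν => ((hKL z hz).1 σ ν).trans ((hF.lepageP h σ ν).2 z hz).symm)
    (fun z hz j σ ν =>
      ((hKL z hz).2.1 j σ ν).trans ((hF.lepageQ h.toOrderRelations j σ ν).2 z hz).symm)
    fun z hz i j σ ν => ((hKL z hz).2.2 i j σ ν).trans ((hF.lepageR i j σ ν).2 z hz).symm)

theorem theorem4_general (hL : ContDiffOn ℝ ∞ L (jetDomain T 2)) :
    (fundCoeffs L).Admissible (jetDomain T 3) ∧
      ∀ K : Coeffs m, K.Admissible (jetDomain T 3) →
        (∀ z ∈ jetDomain T 2, OrderConditionAt L z) →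
        (∀ z ∈ jetDomain T 4, ∀ σ, eulerLagrange L σ z = 0) →
        ((∀ z ∈ jetDomain T 3, extDeriv (ansatz L K) z = 0) ↔
          K.EqOn (fundCoeffs L) (jetDomain T 3)) := by
  obtain ⟨F, hF⟩ := exists_isPullback hL
  have hadm := admissible_fundCoeffs hF
  refine ⟨hadm, fun K hK horder hE => ?_⟩
  have h := hF.trivialRelations horder hE
  refine ⟨fun hclosed => ?_, extDeriv_ansatz_eq_zero hF h hK⟩
  have hfund := extDeriv_ansatz_eq_zero hF h hadm
    fun _ _ => ⟨fun _ _ => rfl, fun _ _ _ => rfl, fun _ _ _ _ => rfl⟩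
  refine coeffs_eqOn_of_ansatz_eqOn hF hK hadm ?_
  exact (hasFrameValues_ansatz_restr hF hK).eqOn_of_extDeriv_eqOn
    (hasFrameValues_ansatz_restr hF hadm) fun z hz => (hclosed z hz).trans (hfund z hz).symm

end Fundamental

end FundLepage

end

theorem theorem4 {m : ℕ} {X Y : Type*}
    [TopologicalSpace X] [ChartedSpace (EuclideanSpace ℝ (Fin 2)) X] [IsManifold (𝓡 2) ∞ X]
    [TopologicalSpace Y] [ChartedSpace (EuclideanSpace ℝ (Fin (2 + m))) Y]
    [IsManifold (𝓡 (2 + m)) ∞ Y]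
    (π : Y → X) (hπ : IsFibered (m := m) π)
    (lam : Lagrangian m π) (hlam : lam.OrderReducible)
    (c : FiberedChart (m := m) π) (L : JetCoords m 2 → ℝ) (hL : lam.IsLagrangeFunction c L) :
    (fundCoeffs L).Admissible (c.domain 3) ∧
      ∀ K : Coeffs m, K.Admissible (c.domain 3) → lam.IsTrivial →
        (c.IsClosedForm (ansatz L K) ↔ K.EqOn (fundCoeffs L) (c.domain 3)) := by
  have hlocal := theorem4_general (T := ⟨c.ψ.target, c.ψ.open_target⟩) hL.1
  exact ⟨hlocal.1, fun K hK htriv => hlocal.2 K hK (hlam c L hL) (htriv c L hL)⟩
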